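/- Let a triangle $ABC$ in the Euclidean plane be tiled by a triangle $R$, that is, let $ABC$ be the union of finitely many congruent copies of $R$ (reflected copies are allowed, and the copies need not meet edge to edge), no two of which have a common interior point. Let $R$ have sides $a,b,c$ and opposite angles $\alpha,\beta,\gamma$, where $\gamma = 2\pi/3$ and not all of $\alpha,\beta,\gamma$ are rational multiples of $\pi$. If $ABC$ is not similar to $R$, then the sides of $R$ are commensurable, i.e. all pairwise ratios of $a,b,c$ are rational. -/

import Mathlib

noncomputable section

namespace TriangleTiling

/-- The Euclidean plane. -/
abbrev Plane : Type := EuclideanSpace ℝ (Fin 2)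

/-- A nondegenerate triangle in the plane, given by its three (affinely independent) labelled
vertices `T.points 0`, `T.points 1`, `T.points 2`. -/
abbrev Tri : Type := Affine.Triangle ℝ Plane

/-- The length of the side opposite to the `i`-th vertex (indices in `Fin 3` are cyclic). -/
def side (T : Tri) (i : Fin 3) : ℝ := dist (T.points (i + 1)) (T.points (i + 2))

/-- The interior angle at the `i`-th vertex, in radians. -/
def angleAt (T : Tri) (i : Fin 3) : ℝ :=
  EuclideanGeometry.angle (T.points (i + 1)) (T.points i) (T.points (i + 2))

/-- `T` and `R` are similar as unlabelled triangles: for some matching of their vertices all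
distances are proportional. Orientation may be reversed. -/
def IsSimilar (T R : Tri) : Prop :=
  ∃ σ : Equiv.Perm (Fin 3), Similar (T.points ∘ σ) R.points

/-- The triangles `t 0, …, t (N - 1)` form a tiling of the triangle `T` by the tile `R`:
each is a congruent copy of `R` (reflections allowed, vertices listed in the corresponding order),
no two of them have a common interior point, and their union is `T`.
The tiles need not meet edge to edge. -/
structure IsTiling (T R : Tri) {N : ℕ} (t : Fin N → Tri) : Prop where
  congruent : ∀ i, Congruent (t i).points R.points
  nonoverlapping : ∀ i j, i ≠ j → Disjoint (t i).interior (t j).interior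
  union_eq : ⋃ i, (t i).closedInterior = T.closedInterior

/-- All angles are rational multiples of `π`. -/
def CommensurableAngles (R : Tri) : Prop :=
  ∀ i, ∃ q : ℚ, angleAt R i = (q : ℝ) * Real.pi

/-- All pairwise ratios of the sides are rational. -/
def CommensurableSides (R : Tri) : Prop :=
  ∀ i j, ∃ q : ℚ, side R i / side R j = (q : ℝ)

end TriangleTiling

end

/-!
Let `α`, `β`, `γ = 2π/3` be the angles of the tile and `a`, `b`, `c` the opposite sides, so that
`α + β = π/3` and `β` is not a rational multiple of `π`. Hence `α`, `β`, `γ` satisfy only the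
obvious rational relation with `π`: if `p`, `q`, `r` tile angles of the three kinds add up to `k π`,
then `p = q` and `q + 2 r = 3 k`. Applied to the sum of the angles of the tiled triangle `W`, this
shows that either the corners of `W` consist of one angle of each kind, in which case `W` is similar
to the tile, or that they consist of three angles `α`, three angles `β` and no angle `γ`. From now on
the second case is assumed. Two independent arguments produce rational relations between `a`, `b`
and `c`.

*The first argument* (`IsCTiling.sum_edgeSum`) uses additive functions. Given an additive
`f : ℝ → ℚ` and an odd function `g` of the direction of an edge, the sums over the edges of
`g (direction) * f (length)` add up, over all tiles, to the corresponding sum for `W`, because edges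
on both sides of a segment cancel. The function `g` can be taken to be a character of the group of
rotations generated by those by `π/3` and `β`; the rotation by `π/3` must be mapped to `-1` since
`g` is odd, the rotation by `β` can be mapped to either sign. As the tile contributes a multiple of
`f (a - b ∓ c)`, two signed sums of the sides of `W` are rational multiples of `a - b - c` and
`a - b + c` (`exists_rat_sum_sides`). For each of the finitely many possible shapes of `W` the law
of sines then yields that `c` is a rational combination of `a` and `b` (`exists_rat_linear`).

*The second argument* (`LabeledTiling.exists_relation`) shows that a positive multiple of `a` is a
sum of sides of length `b` and `c`, and likewise for `b`. Fix `y`, which is `a` or `b`. At a point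
two edges on opposite sides of a line may start in the same direction, exactly one of them being of
length `y`: a *mismatch*. Consecutive edges on one side of a line, exactly one of them being of
length `y`, may meet inside an edge of the other side: a *change*. Each corner with an angle other
than the one opposite to `y` is adjacent to exactly one edge `y`, so a parity argument at each
vertex bounds the number of angles `γ` there by the number of mismatches minus that of changes plus
the total angle divided by `π`. There are as many angles `γ` as tiles, but none at the corners of
`W`, so summation yields more mismatches than changes (`LabeledTiling.card_changes_lt`). On the
other hand, starting at a mismatch one can walk along the two sides of the line until one side
changes its kind. If no multiple of `y` is a sum of the other sides, then the two sides never end at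
the same point, so that each walk ends in a change; as walks can be reversed, this injects the
mismatches into the changes (`LabeledTiling.card_mismatches_le`), a contradiction.

Elimination of `c` from the two relations of the second argument gives that `a / b` is rational, and
by the first argument `c / b` is rational as well.

The geometry is done in the complex plane with counterclockwise triangles `CTri`. The local structure
of a tiling at a point `V` is described by germs of curves `V + ε u + ε² n` with independent `u`
and `n`: such a curve runs in the interior of exactly one tile, or outside of `W`.
-/

noncomputable section

namespace TriangleTiling

open Filter Topology Complex

/-! ### Triangles in the complex plane and their germs -/

/-- The cross product (signed area of the spanned parallelogram) of two plane vectors. -/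
def cross (x y : ℂ) : ℝ := x.re * y.im - x.im * y.re

lemma cross_add_right (x y z : ℂ) : cross x (y + z) = cross x y + cross x z := by
  simp only [cross, add_re, add_im]; ring

lemma cross_mul_right (x y : ℂ) (s : ℝ) : cross x (s * y) = s * cross x y := by
  simp only [cross, re_ofReal_mul, im_ofReal_mul]; ring

lemma cross_mul_left (x y : ℂ) (s : ℝ) : cross (s * x) y = s * cross x y := by
  simp only [cross, re_ofReal_mul, im_ofReal_mul]; ring

lemma cross_neg_right (x y : ℂ) : cross x (-y) = -cross x y := by
  simp only [cross, neg_re, neg_im]; ring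

lemma cross_self (x : ℂ) : cross x x = 0 := by simp only [cross]; ring

lemma cross_swap (x y : ℂ) : cross x y = -cross y x := by simp only [cross]; ring

lemma cross_self_I_mul (x : ℂ) : cross x (I * x) = ‖x‖ ^ 2 := by
  rw [← normSq_eq_norm_sq, normSq_apply]; simp [cross]

/-- Two vectors orthogonal (for `cross`) to a nonzero vector are proportional. -/
lemma eq_zero_of_cross_eq_zero {e u n : ℂ} (h : cross u n ≠ 0) (h1 : cross e u = 0)
    (h2 : cross e n = 0) : e = 0 := by
  simp only [cross] at *
  apply Complex.ext
  · apply (mul_eq_zero.mp (?_ : e.re * (u.re * n.im - u.im * n.re) = 0)).resolve_right h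
    linear_combination u.re * h2 - n.re * h1
  · apply (mul_eq_zero.mp (?_ : e.im * (u.re * n.im - u.im * n.re) = 0)).resolve_right h
    linear_combination u.im * h2 - n.im * h1

/-- A triangle in the complex plane with counterclockwise ordered vertices. -/
structure CTri where
  v : Fin 3 → ℂ
  ccw : 0 < cross (v 1 - v 0) (v 2 - v 0)

namespace CTri

variable (T : CTri)

/-- The edge vector of the edge opposite to the `k`-th vertex, traversed counterclockwise. -/
def ev (k : Fin 3) : ℂ := T.v (k + 2) - T.v (k + 1)

/-- The length of the edge opposite to the `k`-th vertex. -/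
def len (k : Fin 3) : ℝ := ‖T.ev k‖

/-- The unit direction of the `k`-th edge, traversed counterclockwise. -/
def dir (k : Fin 3) : ℂ := T.ev k / T.len k

/-- The linear form which vanishes on the `k`-th edge and is positive on the side of the
triangle. -/
def lam (k : Fin 3) (x : ℂ) : ℝ := cross (T.ev k) (x - T.v (k + 1))

/-- Twice the area. -/
def dbl : ℝ := cross (T.v 1 - T.v 0) (T.v 2 - T.v 0)

lemma dbl_pos : 0 < T.dbl := T.ccw

/-- Membership in the open triangle. -/
def Inside (x : ℂ) : Prop := ∀ k, 0 < T.lam k x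

/-- Membership in the closed triangle. -/
def Closed (x : ℂ) : Prop := ∀ k, 0 ≤ T.lam k x

lemma lam_add (k : Fin 3) (x y : ℂ) : T.lam k (x + y) = T.lam k x + cross (T.ev k) y := by
  rw [lam, lam, ← cross_add_right]; ring_nf

lemma lam_self (k : Fin 3) : T.lam k (T.v k) = T.dbl := by
  fin_cases k <;> simp [lam, ev, dbl, cross] <;> ring

lemma lam_src (k : Fin 3) : T.lam k (T.v (k + 1)) = 0 := by
  simp [lam, cross]

lemma lam_tgt (k : Fin 3) : T.lam k (T.v (k + 2)) = 0 := by
  simp only [lam, ev, cross_self]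

lemma cross_ev_succ (k : Fin 3) : cross (T.ev k) (T.ev (k + 1)) = T.dbl := by
  fin_cases k <;> simp [ev, dbl, cross] <;> ring

lemma cross_succ_ev (k : Fin 3) : cross (T.ev (k + 1)) (T.ev k) = -T.dbl := by
  rw [cross_swap, cross_ev_succ]

lemma cross_ev_succ_succ (k : Fin 3) : cross (T.ev (k + 2)) (T.ev k) = T.dbl := by
  fin_cases k <;> simp [ev, dbl, cross] <;> ring

lemma ev_ne_zero (k : Fin 3) : T.ev k ≠ 0 := by
  intro h
  have := T.cross_ev_succ k
  rw [h] at this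
  have h2 := T.dbl_pos
  simp [cross] at this
  linarith

lemma len_pos (k : Fin 3) : 0 < T.len k := norm_pos_iff.mpr (T.ev_ne_zero k)

lemma ev_eq (k : Fin 3) : T.ev k = T.len k * T.dir k := by
  rw [dir, mul_div_cancel₀]
  exact_mod_cast (T.len_pos k).ne'

lemma norm_dir (k : Fin 3) : ‖T.dir k‖ = 1 := by
  rw [dir, norm_div, norm_real, Real.norm_of_nonneg (T.len_pos k).le]
  exact div_self (T.len_pos k).ne'

lemma dir_ne_zero (k : Fin 3) : T.dir k ≠ 0 := by
  rw [← norm_pos_iff, norm_dir]; exact one_pos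

lemma tgt_eq (k : Fin 3) : T.v (k + 2) = T.v (k + 1) + T.len k * T.dir k := by
  rw [← ev_eq, ev]; ring

lemma index_cases (j k : Fin 3) : j = k ∨ j = k + 1 ∨ j = k + 2 := by
  revert j k; decide

lemma add_one_add_one (k : Fin 3) : k + 1 + 1 = k + 2 := by revert k; decide
lemma add_one_add_two (k : Fin 3) : k + 1 + 2 = k := by revert k; decide
lemma add_two_add_one (k : Fin 3) : k + 2 + 1 = k := by revert k; decide
lemma add_two_add_two (k : Fin 3) : k + 2 + 2 = k + 1 := by revert k; decide

/-- The values of the three linear forms on the line carrying the `k`-th edge. -/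
lemma lam_on_edge (k : Fin 3) (s : ℝ) :
    T.lam k (T.v (k + 1) + s * T.dir k) = 0 ∧
    T.lam (k + 1) (T.v (k + 1) + s * T.dir k) = T.dbl * (1 - s / T.len k) ∧
    T.lam (k + 2) (T.v (k + 1) + s * T.dir k) = T.dbl * (s / T.len k) := by
  have hl := (T.len_pos k).ne'
  have hd : (s : ℂ) * T.dir k = ((s / T.len k : ℝ) : ℂ) * T.ev k := by
    rw [ev_eq]; push_cast
    have : (T.len k : ℂ) ≠ 0 := by exact_mod_cast hl
    field_simp
  refine ⟨?_, ?_, ?_⟩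
  · rw [lam_add, lam_src, hd, cross_mul_right, cross_self]; ring
  · rw [lam_add, hd, cross_mul_right, lam_self, cross_succ_ev]; ring
  · have : T.v (k + 1) = T.v (k + 2 + 2) := by rw [add_two_add_two]
    rw [lam_add, hd, cross_mul_right, this, lam_tgt, cross_ev_succ_succ]; ring

lemma cross_ev_dir_self (k : Fin 3) : cross (T.ev k) (T.dir k) = 0 := by
  rw [ev_eq, cross_mul_left, cross_self, mul_zero]

lemma cross_ev_dir (k : Fin 3) :
    cross (T.ev (k + 1)) (T.dir k) < 0 ∧ 0 < cross (T.ev (k + 2)) (T.dir k) := by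
  have h1 := T.cross_succ_ev k
  have h2 := T.cross_ev_succ_succ k
  rw [T.ev_eq k, cross_mul_right] at h1 h2
  have := T.len_pos k
  have := T.dbl_pos
  constructor <;> by_contra! h <;> nlinarith

lemma cross_ev_I_dir (k : Fin 3) : cross (T.ev k) (I * T.dir k) = T.len k := by
  rw [ev_eq, cross_mul_left, cross_self_I_mul, norm_dir]; ring

lemma dir_injective : Function.Injective T.dir := by
  intro j k h
  rcases index_cases j k with rfl | rfl | rfl
  · rfl
  · have := (T.cross_ev_dir k).1
    rw [← h, cross_ev_dir_self] at this
    exact absurd this (lt_irrefl _)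
  · have := (T.cross_ev_dir k).2
    rw [← h, cross_ev_dir_self] at this
    exact absurd this (lt_irrefl _)

lemma dir_ne_neg_dir (j k : Fin 3) : T.dir j ≠ -T.dir k := by
  intro h
  rcases index_cases j k with rfl | rfl | rfl
  · exact T.dir_ne_zero j (self_eq_neg.mp h)
  · have := (T.cross_ev_dir k).1
    rw [← neg_neg (T.dir k), ← h, cross_neg_right, cross_ev_dir_self] at this
    simp at this
  · have := (T.cross_ev_dir k).2
    rw [← neg_neg (T.dir k), ← h, cross_neg_right, cross_ev_dir_self] at this
    simp at this

end CTri

/-- Positivity of the polynomial `a + b ε + c ε²` for all small `ε > 0`. -/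
def LexPos (a b c : ℝ) : Prop := 0 < a ∨ a = 0 ∧ (0 < b ∨ b = 0 ∧ 0 < c)

lemma LexPos.eventually {a b c : ℝ} (h : LexPos a b c) :
    ∀ᶠ ε : ℝ in 𝓝[>] 0, 0 < a + ε * b + ε ^ 2 * c := by
  rcases h with h | ⟨rfl, h | ⟨rfl, h⟩⟩
  · have : Tendsto (fun ε : ℝ => a + ε * b + ε ^ 2 * c) (𝓝[>] 0) (𝓝 (a + 0 * b + 0 ^ 2 * c)) :=
      (Continuous.tendsto (by fun_prop) 0).mono_left nhdsWithin_le_nhds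
    exact this.eventually (lt_mem_nhds (by simpa using h))
  · have : Tendsto (fun ε : ℝ => b + ε * c) (𝓝[>] 0) (𝓝 (b + 0 * c)) :=
      (Continuous.tendsto (by fun_prop) 0).mono_left nhdsWithin_le_nhds
    filter_upwards [this.eventually (lt_mem_nhds (by simpa using h)), self_mem_nhdsWithin]
      with ε h1 h2
    have h2 : 0 < ε := h2
    nlinarith [mul_pos h2 h1]
  · filter_upwards [self_mem_nhdsWithin] with ε h2
    have h2 : 0 < ε := h2
    have : 0 < ε ^ 2 * c := by positivity
    linarith

lemma lexPos_or_neg {a b c : ℝ} (h : ¬(a = 0 ∧ b = 0 ∧ c = 0)) :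
    LexPos a b c ∨ LexPos (-a) (-b) (-c) := by
  unfold LexPos
  rcases lt_trichotomy a 0 with ha | ha | ha <;> rcases lt_trichotomy b 0 with hb | hb | hb <;>
  rcases lt_trichotomy c 0 with hc | hc | hc <;> simp_all

namespace CTri

/-- The points `V + ε u + ε² n` lie in the triangle for all small `ε > 0`. -/
def Germ (T : CTri) (V u n : ℂ) : Prop :=
  ∀ k, LexPos (T.lam k V) (cross (T.ev k) u) (cross (T.ev k) n)

lemma lam_curve (T : CTri) (k : Fin 3) (V u n : ℂ) (ε : ℝ) :
    T.lam k (V + (ε * u + (ε ^ 2 : ℝ) * n)) =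
      T.lam k V + ε * cross (T.ev k) u + ε ^ 2 * cross (T.ev k) n := by
  rw [lam_add, cross_add_right, cross_mul_right, cross_mul_right]; ring

/-- A curve with independent first and second derivative leaves `V` either through the interior
or through the exterior of the triangle, never along its boundary. -/
lemma germ_eventually (T : CTri) {V u n : ℂ} (h : cross u n ≠ 0) :
    ∀ᶠ ε : ℝ in 𝓝[>] 0, (T.Inside (V + (ε * u + (ε ^ 2 : ℝ) * n)) ↔ T.Germ V u n) ∧
      (T.Closed (V + (ε * u + (ε ^ 2 : ℝ) * n)) ↔ T.Germ V u n) := by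
  have key : ∀ k, ∀ᶠ ε : ℝ in 𝓝[>] 0,
      (0 < T.lam k (V + (ε * u + (ε ^ 2 : ℝ) * n)) ↔
        LexPos (T.lam k V) (cross (T.ev k) u) (cross (T.ev k) n)) ∧
      (0 ≤ T.lam k (V + (ε * u + (ε ^ 2 : ℝ) * n)) ↔
        LexPos (T.lam k V) (cross (T.ev k) u) (cross (T.ev k) n)) := by
    intro k
    by_cases hp : LexPos (T.lam k V) (cross (T.ev k) u) (cross (T.ev k) n)
    · filter_upwards [hp.eventually] with ε hε
      rw [lam_curve]
      exact ⟨⟨fun _ => hp, fun _ => hε⟩, ⟨fun _ => hp, fun _ => hε.le⟩⟩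
    · have hn := (lexPos_or_neg (a := T.lam k V) (b := cross (T.ev k) u) (c := cross (T.ev k) n)
        (fun h0 => T.ev_ne_zero k (eq_zero_of_cross_eq_zero h h0.2.1 h0.2.2))).resolve_left hp
      filter_upwards [hn.eventually] with ε hε
      rw [lam_curve]
      exact ⟨⟨fun h => by linarith, fun h => absurd h hp⟩,
        ⟨fun h => by linarith, fun h => absurd h hp⟩⟩
  filter_upwards [eventually_all.mpr key] with ε hε
  exact ⟨forall_congr' fun k => (hε k).1, forall_congr' fun k => (hε k).2⟩

/-- The germ at `V` in direction `u` runs along the `k`-th edge with the triangle on its left. -/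
def EdgeL (T : CTri) (k : Fin 3) (V u : ℂ) : Prop :=
  T.dir k = u ∧ ∃ s : ℝ, 0 ≤ s ∧ s < T.len k ∧ V = T.v (k + 1) + s * T.dir k

/-- The germ at `V` in direction `u` runs along the `k`-th edge with the triangle on its right. -/
def EdgeR (T : CTri) (k : Fin 3) (V u : ℂ) : Prop :=
  T.dir k = -u ∧ ∃ s : ℝ, 0 < s ∧ s ≤ T.len k ∧ V = T.v (k + 1) + s * T.dir k

/-- The second derivative of the curve matters only for germs along an edge. -/
lemma lexPos_congr {a b c c' : ℝ} (h : ¬(a = 0 ∧ b = 0)) : LexPos a b c ↔ LexPos a b c' := by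
  unfold LexPos
  tauto

lemma germ_of_edgeL {T : CTri} {k : Fin 3} {V u : ℂ} (h : T.EdgeL k V u) :
    T.Germ V u (I * u) ∧ ¬ T.Germ V u (-(I * u)) := by
  obtain ⟨rfl, s, h0, h1, rfl⟩ := h
  obtain ⟨e0, e1, e2⟩ := T.lam_on_edge k s
  have hl := T.len_pos k
  have hd := T.dbl_pos
  constructor
  · intro j
    rcases index_cases j k with rfl | rfl | rfl
    · exact Or.inr ⟨e0, Or.inr ⟨T.cross_ev_dir_self _, by rw [cross_ev_I_dir]; exact hl⟩⟩
    · left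
      rw [e1]
      have : s / T.len k < 1 := (div_lt_one hl).mpr h1
      exact mul_pos hd (by linarith)
    · rcases h0.eq_or_lt with rfl | h0
      · exact Or.inr ⟨by rw [e2]; simp, Or.inl (T.cross_ev_dir k).2⟩
      · left; rw [e2]; positivity
  · intro h
    have h := h k
    rw [e0, cross_ev_dir_self, cross_neg_right, cross_ev_I_dir] at h
    simp only [LexPos] at h
    simp at h
    linarith

lemma germ_of_edgeR {T : CTri} {k : Fin 3} {V u : ℂ} (h : T.EdgeR k V u) :
    ¬ T.Germ V u (I * u) ∧ T.Germ V u (-(I * u)) := by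
  obtain ⟨hu, s, h0, h1, rfl⟩ := h
  obtain rfl : u = -T.dir k := by rw [hu, neg_neg]
  obtain ⟨e0, e1, e2⟩ := T.lam_on_edge k s
  have hl := T.len_pos k
  have hd := T.dbl_pos
  constructor
  · intro h
    have h := h k
    rw [e0, mul_neg, cross_neg_right, cross_ev_dir_self, cross_neg_right, cross_ev_I_dir] at h
    simp only [LexPos] at h
    simp at h
    linarith
  · intro j
    rw [mul_neg, neg_neg, cross_neg_right]
    rcases index_cases j k with rfl | rfl | rfl
    · exact Or.inr ⟨e0, Or.inr ⟨by rw [T.cross_ev_dir_self, neg_zero],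
        by rw [cross_ev_I_dir]; exact hl⟩⟩
    · rcases h1.eq_or_lt with rfl | h1
      · exact Or.inr ⟨by rw [e1, div_self hl.ne']; simp,
          Or.inl (neg_pos.mpr (T.cross_ev_dir k).1)⟩
      · left
        rw [e1]
        have : s / T.len k < 1 := (div_lt_one hl).mpr h1
        exact mul_pos hd (by linarith)
    · left; rw [e2]; positivity

/-- A point on the line of the `k`-th edge is given by its position along the edge. -/
lemma exists_pos_of_lam_eq_zero (T : CTri) {k : Fin 3} {V : ℂ} (h : T.lam k V = 0) :
    ∃ s : ℝ, V = T.v (k + 1) + s * T.dir k := by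
  have hl := T.len_pos k
  have hn : T.ev k ≠ 0 := T.ev_ne_zero k
  have hns : normSq (T.ev k) ≠ 0 := by simpa using hn
  refine ⟨((V - T.v (k + 1)) / T.dir k).re, ?_⟩
  have : ((V - T.v (k + 1)) / T.dir k).im = 0 := by
    have : (V - T.v (k + 1)) / T.dir k = T.len k * ((V - T.v (k + 1)) / T.ev k) := by
      rw [dir]; field_simp
    rw [this, im_ofReal_mul, div_im]
    have h' : (T.ev k).re * (V - T.v (k + 1)).im - (T.ev k).im * (V - T.v (k + 1)).re = 0 := h
    have : (V - T.v (k + 1)).im * (T.ev k).re / normSq (T.ev k) -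
      (V - T.v (k + 1)).re * (T.ev k).im / normSq (T.ev k) = 0 := by
      rw [← sub_div]; rw [div_eq_zero_iff]; left; linarith
    rw [this, mul_zero]
  have h2 : (((V - T.v (k + 1)) / T.dir k).re : ℂ) = (V - T.v (k + 1)) / T.dir k := by
    apply Complex.ext <;> simp [this]
  rw [h2, div_mul_cancel₀ _ (T.dir_ne_zero k)]
  ring

/-- Two unit vectors with vanishing cross product are equal up to sign. -/
lemma eq_or_eq_neg_dir (T : CTri) {k : Fin 3} {u : ℂ} (hu : ‖u‖ = 1)
    (h : cross (T.ev k) u = 0) : T.dir k = u ∨ T.dir k = -u := by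
  obtain ⟨s, hs⟩ := T.exists_pos_of_lam_eq_zero (k := k) (V := T.v (k + 1) + u)
    (by rw [lam_add, lam_src, h, add_zero])
  have hs : u = s * T.dir k := by simpa using hs
  have : |s| = 1 := by
    have := congrArg norm hs
    rwa [norm_mul, norm_dir, mul_one, norm_real, hu, Real.norm_eq_abs, eq_comm] at this
  rcases eq_or_eq_neg_of_abs_eq this with rfl | rfl
  · left; simp [hs]
  · right; simp [hs]

/-- If the two sides of a germ are not both inside or both outside of the triangle, the germ runs
along an edge. -/
lemma germ_iff_germ (T : CTri) {V u : ℂ} (hu : ‖u‖ = 1) (hL : ∀ k, ¬ T.EdgeL k V u)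
    (hR : ∀ k, ¬ T.EdgeR k V u) : T.Germ V u (I * u) ↔ T.Germ V u (-(I * u)) := by
  by_cases hk : ∃ k, T.lam k V = 0 ∧ cross (T.ev k) u = 0
  · obtain ⟨k, h1, h2⟩ := hk
    obtain ⟨s, rfl⟩ := T.exists_pos_of_lam_eq_zero h1
    obtain ⟨e0, e1, e2⟩ := T.lam_on_edge k s
    have hl := T.len_pos k
    have hd := T.dbl_pos
    have c1 := (T.cross_ev_dir k).1
    have c2 := (T.cross_ev_dir k).2
    -- On the line of the edge but off the edge, no germ along this line enters the triangle.
    rcases T.eq_or_eq_neg_dir hu h2 with h | h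
    · subst h
      have key : ∀ n, ¬ T.Germ (T.v (k + 1) + s * T.dir k) (T.dir k) n := by
        intro n hg
        refine hL k ⟨rfl, s, ?_, ?_, rfl⟩
        · have := hg (k + 2)
          rw [e2] at this
          by_contra! hs
          have : T.dbl * (s / T.len k) < 0 :=
            mul_neg_of_pos_of_neg hd (div_neg_of_neg_of_pos hs hl)
          simp only [LexPos] at *
          rcases ‹_ ∨ _› with h | h <;> linarith
        · have := hg (k + 1)
          rw [e1] at this
          by_contra! hs
          have h3 : 1 ≤ s / T.len k := (one_le_div hl).mpr hs
          have : T.dbl * (1 - s / T.len k) ≤ 0 :=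
            mul_nonpos_of_nonneg_of_nonpos hd.le (by linarith)
          simp only [LexPos] at *
          rcases ‹_ ∨ _› with h | ⟨h, h | h⟩ <;> linarith
      simp [key]
    · obtain rfl : u = -T.dir k := by rw [h, neg_neg]
      have key : ∀ n, ¬ T.Germ (T.v (k + 1) + s * T.dir k) (-T.dir k) n := by
        intro n hg
        refine hR k ⟨by simp, s, ?_, ?_, rfl⟩
        · have := hg (k + 2)
          rw [e2, cross_neg_right] at this
          by_contra! hs
          have : T.dbl * (s / T.len k) ≤ 0 :=
            mul_nonpos_of_nonneg_of_nonpos hd.le (div_nonpos_of_nonpos_of_nonneg hs hl.le)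
          simp only [LexPos] at *
          rcases ‹_ ∨ _› with h | ⟨h, h | h⟩ <;> linarith
        · have := hg (k + 1)
          rw [e1, cross_neg_right] at this
          by_contra! hs
          have h3 : 1 < s / T.len k := (one_lt_div hl).mpr hs
          have : T.dbl * (1 - s / T.len k) < 0 :=
            mul_neg_of_pos_of_neg hd (by linarith)
          simp only [LexPos] at *
          rcases ‹_ ∨ _› with h | h <;> linarith
      simp [key]
  · push Not at hk
    exact forall_congr' fun k => lexPos_congr fun h => hk k h.1 h.2

end CTri

/-! ### The balance of edges in a tiling -/

open scoped Classical in
/-- The number of edges of the triangle with the triangle to the left of the germ at `V` in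
direction `u`, minus the number of edges with the triangle to its right. -/
def CTri.edgeBalance (T : CTri) (V u : ℂ) : ℤ :=
  ∑ k, ((if T.EdgeL k V u then 1 else 0) - (if T.EdgeR k V u then 1 else 0))

open scoped Classical in
/-- The edge balance is the jump of the indicator function of the triangle across the germ, which is
additive over tilings. -/
lemma CTri.edgeBalance_eq (T : CTri) {V u : ℂ} (hu : ‖u‖ = 1) :
    T.edgeBalance V u =
      (if T.Germ V u (I * u) then 1 else 0) - (if T.Germ V u (-(I * u)) then 1 else 0) := by
  unfold edgeBalance
  by_cases hL : ∃ k, T.EdgeL k V u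
  · obtain ⟨k, hk⟩ := hL
    have hR : ∀ j, ¬ T.EdgeR j V u := fun j hj =>
      T.dir_ne_neg_dir j k (by rw [hj.1, hk.1])
    have hL : ∀ j, T.EdgeL j V u ↔ j = k := fun j =>
      ⟨fun hj => T.dir_injective (by rw [hj.1, hk.1]), fun hj => hj ▸ hk⟩
    simp [hL, hR, germ_of_edgeL hk]
  · push Not at hL
    by_cases hR : ∃ k, T.EdgeR k V u
    · obtain ⟨k, hk⟩ := hR
      have hR : ∀ j, T.EdgeR j V u ↔ j = k := fun j =>
        ⟨fun hj => T.dir_injective (by rw [hj.1, hk.1]), fun hj => hj ▸ hk⟩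
      simp [hL, hR, germ_of_edgeR hk]
    · push Not at hR
      simp [hL, hR, T.germ_iff_germ hu hL hR]

/-- The triangles `T i` form a tiling of the triangle `W`. -/
structure IsCTiling {ι : Type*} (T : ι → CTri) (W : CTri) : Prop where
  disjoint : ∀ i j x, (T i).Inside x → (T j).Inside x → i = j
  cover : ∀ x, (∃ i, (T i).Closed x) ↔ W.Closed x

namespace IsCTiling

variable {ι : Type*} [Fintype ι] {T : ι → CTri} {W : CTri}

/-- Each germ that enters the tiled triangle enters exactly one tile. -/
lemma germ_unique_and_iff (h : IsCTiling T W) {V u n : ℂ} (hun : cross u n ≠ 0) :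
    (∀ i j, (T i).Germ V u n → (T j).Germ V u n → i = j) ∧
      ((∃ i, (T i).Germ V u n) ↔ W.Germ V u n) := by
  have h1 := eventually_all.mpr fun i => (T i).germ_eventually (V := V) hun
  obtain ⟨ε, hT, hW⟩ := (h1.and (W.germ_eventually (V := V) hun)).exists
  refine ⟨fun i j hi hj => h.disjoint i j _ ((hT i).1.mpr hi) ((hT j).1.mpr hj), ?_⟩
  rw [← hW.2, ← h.cover]
  exact exists_congr fun i => (hT i).2.symm

open scoped Classical in
lemma sum_germ (h : IsCTiling T W) {V u n : ℂ} (hun : cross u n ≠ 0) {R : Type*}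
    [NonAssocSemiring R] :
    ∑ i, (if (T i).Germ V u n then (1 : R) else 0) = if W.Germ V u n then 1 else 0 := by
  obtain ⟨hu, he⟩ := h.germ_unique_and_iff (V := V) hun
  by_cases hW : W.Germ V u n
  · obtain ⟨i, hi⟩ := he.mpr hW
    have : ∀ j, (T j).Germ V u n ↔ j = i := fun j => ⟨fun hj => hu j i hj hi, fun hj => hj ▸ hi⟩
    simp [this, hW]
  · have : ∀ j, ¬ (T j).Germ V u n := fun j hj => hW (he.mp ⟨j, hj⟩)
    simp [this, hW]

lemma cross_I_ne_zero {u : ℂ} (hu : ‖u‖ = 1) : cross u (I * u) ≠ 0 := by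
  rw [cross_self_I_mul, hu]; norm_num

lemma cross_neg_I_ne_zero {u : ℂ} (hu : ‖u‖ = 1) : cross u (-(I * u)) ≠ 0 := by
  rw [cross_neg_right, cross_self_I_mul, hu]; norm_num

/-- In a tiling the edges on the two sides of a germ balance, up to the edges of the tiled
triangle. -/
theorem edge_balance (h : IsCTiling T W) (V : ℂ) {u : ℂ} (hu : ‖u‖ = 1) :
    ∑ i, (T i).edgeBalance V u = W.edgeBalance V u := by
  classical
  simp_rw [CTri.edgeBalance_eq _ hu, Finset.sum_sub_distrib]
  rw [h.sum_germ (cross_I_ne_zero hu), h.sum_germ (cross_neg_I_ne_zero hu)]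

lemma edgeL_unique (h : IsCTiling T W) {V u : ℂ} {i j : ι} {k l : Fin 3}
    (h1 : (T i).EdgeL k V u) (h2 : (T j).EdgeL l V u) : i = j ∧ k = l := by
  have hu : ‖u‖ = 1 := h1.1 ▸ (T i).norm_dir k
  obtain rfl := (h.germ_unique_and_iff (V := V) (cross_I_ne_zero hu)).1 i j
    (CTri.germ_of_edgeL h1).1 (CTri.germ_of_edgeL h2).1
  exact ⟨rfl, (T i).dir_injective (by rw [h1.1, h2.1])⟩

lemma edgeR_unique (h : IsCTiling T W) {V u : ℂ} {i j : ι} {k l : Fin 3}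
    (h1 : (T i).EdgeR k V u) (h2 : (T j).EdgeR l V u) : i = j ∧ k = l := by
  have hu : ‖u‖ = 1 := by
    rw [← norm_neg, ← h1.1]; exact (T i).norm_dir k
  obtain rfl := (h.germ_unique_and_iff (V := V) (cross_neg_I_ne_zero hu)).1 i j
    (CTri.germ_of_edgeR h1).2 (CTri.germ_of_edgeR h2).2
  exact ⟨rfl, (T i).dir_injective (by rw [h1.1, h2.1])⟩

end IsCTiling

/-! ### Angles -/

namespace CTri

variable (T : CTri)

/-- The interior angle at the `m`-th vertex. -/
def ang (m : Fin 3) : ℝ := arg ((T.v (m + 2) - T.v m) / (T.v (m + 1) - T.v m))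

lemma neg_dir_div_dir (m : Fin 3) :
    -T.dir (m + 1) / T.dir (m + 2) = (T.len (m + 2) / T.len (m + 1) : ℝ) *
      ((T.v (m + 2) - T.v m) / (T.v (m + 1) - T.v m)) := by
  have h1 : T.ev (m + 1) = T.v m - T.v (m + 2) := by
    rw [ev, add_one_add_two, add_one_add_one]
  have h2 : T.ev (m + 2) = T.v (m + 1) - T.v m := by
    rw [ev, add_two_add_two, add_two_add_one]
  rw [dir, dir, h1, h2]
  have e1 : (T.len (m + 1) : ℂ) ≠ 0 := by exact_mod_cast (T.len_pos _).ne'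
  have e2 : (T.len (m + 2) : ℂ) ≠ 0 := by exact_mod_cast (T.len_pos _).ne'
  have e3 : T.v (m + 1) - T.v m ≠ 0 := h2 ▸ T.ev_ne_zero (m + 2)
  push_cast
  field_simp
  ring

/-- The turning of the directions at a vertex. -/
lemma dir_succ (m : Fin 3) : T.dir (m + 1) = -(exp (T.ang m * I) * T.dir (m + 2)) := by
  have h := T.neg_dir_div_dir m
  have hpos : 0 < T.len (m + 2) / T.len (m + 1) := div_pos (T.len_pos _) (T.len_pos _)
  have hn : ‖-T.dir (m + 1) / T.dir (m + 2)‖ = 1 := by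
    rw [norm_div, norm_neg, norm_dir, norm_dir, div_one]
  have ha : arg (-T.dir (m + 1) / T.dir (m + 2)) = T.ang m := by
    rw [h, arg_real_mul _ hpos]; rfl
  have := norm_mul_exp_arg_mul_I (-T.dir (m + 1) / T.dir (m + 2))
  rw [hn, ha, ofReal_one, one_mul] at this
  rw [this, div_mul_cancel₀ _ (T.dir_ne_zero _), neg_neg]

lemma ang_mem (m : Fin 3) : 0 < T.ang m ∧ T.ang m < Real.pi := by
  have h := T.dir_succ m
  have hc : 0 < Real.sin (T.ang m) := by
    have h1 := (T.cross_ev_dir (m + 1)).1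
    rw [add_one_add_one, ev_eq, cross_mul_left, h, cross_neg_right] at h1
    have hl := T.len_pos (m + 2)
    have : cross (T.dir (m + 2)) (exp (T.ang m * I) * T.dir (m + 2)) = Real.sin (T.ang m) := by
      have hn : (T.dir (m + 2)).re * (T.dir (m + 2)).re +
          (T.dir (m + 2)).im * (T.dir (m + 2)).im = 1 := by
        rw [← normSq_apply, normSq_eq_norm_sq, norm_dir]; norm_num
      rw [exp_mul_I]
      simp only [cross, mul_re, mul_im, add_re, add_im, I_re, I_im, ← ofReal_cos, ← ofReal_sin,
        ofReal_re, ofReal_im]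
      linear_combination Real.sin (T.ang m) * hn
    rw [this] at h1
    nlinarith
  have h1 := arg_le_pi ((T.v (m + 2) - T.v m) / (T.v (m + 1) - T.v m))
  have h2 := neg_pi_lt_arg ((T.v (m + 2) - T.v m) / (T.v (m + 1) - T.v m))
  change T.ang m ≤ _ at h1
  change _ < T.ang m at h2
  constructor
  · by_contra! h3
    exact absurd (Real.sin_nonpos_of_nonpos_of_neg_pi_le h3 h2.le) (not_le.mpr hc)
  · refine lt_of_le_of_ne h1 fun h3 => ?_
    rw [h3, Real.sin_pi] at hc
    exact lt_irrefl _ hc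

open scoped Classical in
/-- The indicator function of the directions at `V` which point into the triangle. -/
def sector (V : ℂ) (φ : ℝ) : ℝ :=
  if T.Germ V (exp (φ * I)) (I * exp (φ * I)) then 1 else 0

lemma sector_periodic (V : ℂ) : Function.Periodic (T.sector V) (2 * Real.pi) := by
  intro φ
  have : exp (((φ + 2 * Real.pi : ℝ) : ℂ) * I) = exp (φ * I) := by
    rw [exp_eq_exp_iff_exists_int]
    exact ⟨1, by push_cast; ring⟩
  unfold sector
  rw [this]

lemma measurable_sector (V : ℂ) : Measurable (T.sector V) := by
  classical
  refine Measurable.ite ?_ measurable_const measurable_const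
  have hc : ∀ k, Continuous fun φ : ℝ => cross (T.ev k) (exp (φ * I)) := fun k => by
    unfold cross; fun_prop
  have hc' : ∀ k, Continuous fun φ : ℝ => cross (T.ev k) (I * exp (φ * I)) := fun k => by
    unfold cross; fun_prop
  simp only [Germ, LexPos, Set.ofPred_forall, Set.ofPred_or, Set.ofPred_and]
  refine MeasurableSet.iInter fun k => ?_
  refine (MeasurableSet.const _).union ((MeasurableSet.const _).inter
    ((measurableSet_lt measurable_const (hc k).measurable).union
      ((measurableSet_eq_fun (hc k).measurable measurable_const).inter
        (measurableSet_lt measurable_const (hc' k).measurable))))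

lemma intervalIntegrable_sector (V : ℂ) (s t : ℝ) :
    IntervalIntegrable (T.sector V) MeasureTheory.volume s t := by
  refine (intervalIntegrable_const (c := (1 : ℝ))).mono_fun
    (T.measurable_sector V).aestronglyMeasurable ?_
  filter_upwards with φ
  unfold sector
  split_ifs <;> simp

/-- The angle under which the triangle is seen from `V`, in the sense that it measures the set
of directions pointing into the triangle. -/
def theta (V : ℂ) : ℝ := ∫ φ in (0 : ℝ)..2 * Real.pi, T.sector V φ

/-- If the directions with arguments between `ψ` and `ψ + θ` are those which point into the
triangle, then the angle is `θ`. -/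
lemma theta_eq {V : ℂ} {ψ θ : ℝ} (h0 : 0 ≤ θ) (h1 : θ ≤ 2 * Real.pi)
    (hin : ∀ t, 0 < t → t < θ → T.Germ V (exp ((ψ + t : ℝ) * I)) (I * exp ((ψ + t : ℝ) * I)))
    (hout : ∀ t, θ < t → t < 2 * Real.pi →
      ¬ T.Germ V (exp ((ψ + t : ℝ) * I)) (I * exp ((ψ + t : ℝ) * I))) :
    T.theta V = θ := by
  have e0 : T.theta V = ∫ φ in ψ..ψ + 2 * Real.pi, T.sector V φ := by
    have := (T.sector_periodic V).intervalIntegral_add_eq 0 ψ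
    rwa [zero_add] at this
  have h1' : ∫ φ in ψ..ψ + θ, T.sector V φ = ∫ φ in ψ..ψ + θ, (1 : ℝ) := by
    refine intervalIntegral.integral_congr_Ioo_of_le (by linarith) fun x hx => ?_
    have := hin (x - ψ) (by linarith [hx.1]) (by linarith [hx.2])
    rw [add_sub_cancel] at this
    simp only [sector, this, if_true]
  have h2' : ∫ φ in ψ + θ..ψ + 2 * Real.pi, T.sector V φ =
      ∫ φ in ψ + θ..ψ + 2 * Real.pi, (0 : ℝ) := by
    refine intervalIntegral.integral_congr_Ioo_of_le (by linarith) fun x hx => ?_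
    have := hout (x - ψ) (by linarith [hx.1]) (by linarith [hx.2])
    rw [add_sub_cancel] at this
    simp only [sector, this, if_false]
  rw [e0, ← intervalIntegral.integral_add_adjacent_intervals (b := ψ + θ)
    (T.intervalIntegrable_sector V _ _) (T.intervalIntegrable_sector V _ _), h1', h2']
  simp

lemma theta_of_inside {V : ℂ} (h : T.Inside V) : T.theta V = 2 * Real.pi :=
  T.theta_eq (ψ := 0) (by positivity) le_rfl (fun _ _ _ k => Or.inl (h k))
    (fun t h1 h2 => absurd (h1.trans h2) (lt_irrefl _))

lemma theta_of_not_closed {V : ℂ} (h : ¬ T.Closed V) : T.theta V = 0 := by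
  refine T.theta_eq (ψ := 0) le_rfl (by positivity)
    (fun t h1 h2 => absurd (h1.trans h2) (lt_irrefl _)) (fun t _ _ hg => h fun k => ?_)
  rcases hg k with h | ⟨h, _⟩
  · exact h.le
  · exact h.ge

lemma cross_exp (x y : ℝ) : cross (exp (x * I)) (exp (y * I)) = Real.sin (y - x) := by
  rw [exp_mul_I, exp_mul_I, Real.sin_sub]
  simp only [cross, mul_re, mul_im, add_re, add_im, I_re, I_im, ← ofReal_cos, ← ofReal_sin,
    ofReal_re, ofReal_im]
  ring

lemma exp_arg_dir (k : Fin 3) : T.dir k = exp ((arg (T.dir k) : ℝ) * I) := by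
  have := norm_mul_exp_arg_mul_I (T.dir k)
  rwa [norm_dir, ofReal_one, one_mul, eq_comm] at this

lemma cross_ev_exp (k : Fin 3) (t : ℝ) :
    cross (T.ev k) (exp (((arg (T.dir k) + t : ℝ) : ℂ) * I)) = T.len k * Real.sin t := by
  rw [ev_eq, cross_mul_left]
  conv_lhs => rw [T.exp_arg_dir k]
  rw [cross_exp, ← exp_arg_dir, add_sub_cancel_left]

/-- Membership in the relative interior of the `k`-th edge. -/
def OnEdge (k : Fin 3) (V : ℂ) : Prop :=
  ∃ s : ℝ, 0 < s ∧ s < T.len k ∧ V = T.v (k + 1) + s * T.dir k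

lemma OnEdge.lam {T : CTri} {k : Fin 3} {V : ℂ} (h : T.OnEdge k V) :
    T.lam k V = 0 ∧ 0 < T.lam (k + 1) V ∧ 0 < T.lam (k + 2) V := by
  obtain ⟨s, h0, h1, rfl⟩ := h
  obtain ⟨e0, e1, e2⟩ := T.lam_on_edge k s
  have hl := T.len_pos k
  have hd := T.dbl_pos
  refine ⟨e0, ?_, ?_⟩
  · rw [e1]
    have : s / T.len k < 1 := (div_lt_one hl).mpr h1
    exact mul_pos hd (by linarith)
  · rw [e2]; positivity

lemma theta_of_onEdge {k : Fin 3} {V : ℂ} (h : T.OnEdge k V) : T.theta V = Real.pi := by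
  obtain ⟨e0, e1, e2⟩ := h.lam
  have hl := T.len_pos k
  have hp := Real.pi_pos
  refine T.theta_eq (ψ := arg (T.dir k)) hp.le (by linarith) (fun t h1 h2 j => ?_)
    (fun t h1 h2 hg => ?_)
  · rcases index_cases j k with rfl | rfl | rfl
    · refine Or.inr ⟨e0, Or.inl ?_⟩
      rw [cross_ev_exp]
      exact mul_pos hl (Real.sin_pos_of_pos_of_lt_pi h1 h2)
    · exact Or.inl e1
    · exact Or.inl e2
  · have hg := hg k
    have : Real.sin t < 0 := by
      rw [← Real.sin_sub_two_pi]
      exact Real.sin_neg_of_neg_of_neg_pi_lt (by linarith) (by linarith)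
    rw [e0, cross_ev_exp] at hg
    have h3 : T.len k * Real.sin t < 0 := mul_neg_of_pos_of_neg hl this
    rcases hg with h | ⟨_, h | ⟨h, _⟩⟩ <;> linarith

lemma theta_vertex (m : Fin 3) : T.theta (T.v m) = T.ang m := by
  obtain ⟨ha0, ha1⟩ := T.ang_mem m
  have hl1 := T.len_pos (m + 1)
  have hl2 := T.len_pos (m + 2)
  have e0 : T.lam m (T.v m) = T.dbl := T.lam_self m
  have e1 : T.lam (m + 1) (T.v m) = 0 := by
    have := T.lam_tgt (m + 1); rwa [add_one_add_two] at this
  have e2 : T.lam (m + 2) (T.v m) = 0 := by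
    have := T.lam_src (m + 2); rwa [add_two_add_one] at this
  have hc : ∀ t : ℝ, cross (T.ev (m + 1)) (exp (((arg (T.dir (m + 2)) + t : ℝ) : ℂ) * I)) =
      T.len (m + 1) * Real.sin (T.ang m - t) := by
    intro t
    have : exp (T.ang m * I) * T.dir (m + 2) =
        exp (((arg (T.dir (m + 2)) + T.ang m : ℝ) : ℂ) * I) := by
      conv_lhs => rw [T.exp_arg_dir (m + 2)]
      rw [← exp_add]; congr 1; push_cast; ring
    rw [ev_eq, cross_mul_left, dir_succ, this, cross_swap, cross_neg_right, cross_exp, neg_neg,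
      add_sub_add_left_eq_sub]
  -- The directions into the triangle start with that of the edge which leaves the vertex.
  refine T.theta_eq (ψ := arg (T.dir (m + 2))) ha0.le (by linarith) (fun t h1 h2 j => ?_)
    (fun t h1 h2 hg => ?_)
  · rcases index_cases j m with rfl | rfl | rfl
    · left; rw [e0]; exact T.dbl_pos
    · refine Or.inr ⟨e1, Or.inl ?_⟩
      rw [hc]
      exact mul_pos hl1 (Real.sin_pos_of_pos_of_lt_pi (by linarith) (by linarith))
    · refine Or.inr ⟨e2, Or.inl ?_⟩
      rw [cross_ev_exp]
      exact mul_pos hl2 (Real.sin_pos_of_pos_of_lt_pi (by linarith) (by linarith))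
  · by_cases h3 : t < Real.pi
    · have hg := hg (m + 1)
      have : Real.sin (T.ang m - t) < 0 :=
        Real.sin_neg_of_neg_of_neg_pi_lt (by linarith) (by linarith)
      rw [e1, hc] at hg
      have h3 : T.len (m + 1) * Real.sin (T.ang m - t) < 0 := mul_neg_of_pos_of_neg hl1 this
      rcases hg with h | ⟨_, h | ⟨h, _⟩⟩ <;> linarith
    · have hg2 := hg (m + 2)
      have hg1 := hg (m + 1)
      rw [e2, cross_ev_exp] at hg2
      rw [e1, hc] at hg1
      rcases (not_lt.mp h3).eq_or_lt with h3 | h3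
      · have hs : Real.sin (T.ang m - t) < 0 := by
          rw [← h3, Real.sin_sub_pi]
          exact neg_neg_of_pos (Real.sin_pos_of_pos_of_lt_pi ha0 ha1)
        have h3 : T.len (m + 1) * Real.sin (T.ang m - t) < 0 := mul_neg_of_pos_of_neg hl1 hs
        rcases hg1 with h | ⟨_, h | ⟨h, _⟩⟩ <;> linarith
      · have : Real.sin t < 0 := by
          rw [← Real.sin_sub_two_pi]
          exact Real.sin_neg_of_neg_of_neg_pi_lt (by linarith) (by linarith)
        have h3 : T.len (m + 2) * Real.sin t < 0 := mul_neg_of_pos_of_neg hl2 this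
        rcases hg2 with h | ⟨_, h | ⟨h, _⟩⟩ <;> linarith

lemma v_injective : Function.Injective T.v := by
  intro j k h
  rcases index_cases j k with rfl | rfl | rfl
  · rfl
  · exact absurd (by rw [← T.lam_self k, ← h, lam_src]) T.dbl_pos.ne
  · exact absurd (by rw [← T.lam_self k, ← h, lam_tgt]) T.dbl_pos.ne

/-- A point of the closed triangle is a vertex, or lies in the relative interior of an edge, or is
an interior point. -/
lemma closed_cases {V : ℂ} (h : T.Closed V) :
    (∃ m, T.v m = V) ∨ (∃ k, T.OnEdge k V) ∨ T.Inside V := by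
  by_cases hi : T.Inside V
  · exact Or.inr (Or.inr hi)
  · simp only [Inside, not_forall, not_lt] at hi
    obtain ⟨k, hk⟩ := hi
    obtain ⟨s, rfl⟩ := T.exists_pos_of_lam_eq_zero (le_antisymm hk (h k))
    obtain ⟨e0, e1, e2⟩ := T.lam_on_edge k s
    have hl := T.len_pos k
    have hd := T.dbl_pos
    have h1 := h (k + 1)
    have h2 := h (k + 2)
    rw [e1] at h1
    rw [e2] at h2
    have h2 : 0 ≤ s := by
      by_contra! hs
      have : T.dbl * (s / T.len k) < 0 :=
        mul_neg_of_pos_of_neg hd (div_neg_of_neg_of_pos hs hl)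
      linarith
    have h1 : s ≤ T.len k := by
      by_contra! hs
      have h3 : 1 < s / T.len k := (one_lt_div hl).mpr hs
      have : T.dbl * (1 - s / T.len k) < 0 :=
        mul_neg_of_pos_of_neg hd (by linarith)
      linarith
    rcases h2.eq_or_lt with rfl | h2
    · left; exact ⟨k + 1, by simp⟩
    · rcases h1.eq_or_lt with rfl | h1
      · left; exact ⟨k + 2, T.tgt_eq k⟩
      · right; left; exact ⟨k, s, h2, h1, rfl⟩

lemma closed_vertex (m : Fin 3) : T.Closed (T.v m) := by
  intro j
  rcases index_cases j m with rfl | rfl | rfl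
  · rw [lam_self]; exact T.dbl_pos.le
  · have := T.lam_tgt (m + 1)
    rw [add_one_add_two] at this
    exact this.ge
  · have := T.lam_src (m + 2)
    rw [add_two_add_one] at this
    exact this.ge

lemma OnEdge.unique {T : CTri} {j k : Fin 3} {V : ℂ} (h : T.OnEdge j V) (h' : T.OnEdge k V) :
    j = k := by
  obtain ⟨h0, h1, h2⟩ := h'.lam
  obtain ⟨h3, -, -⟩ := h.lam
  rcases index_cases j k with rfl | rfl | rfl
  · rfl
  · exact absurd h3 h1.ne'
  · exact absurd h3 h2.ne'

lemma not_onEdge_vertex (k m : Fin 3) : ¬ T.OnEdge k (T.v m) := fun h => by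
  have h1 := T.theta_of_onEdge h
  rw [theta_vertex] at h1
  exact (T.ang_mem m).2.ne h1

lemma not_inside_vertex (m : Fin 3) : ¬ T.Inside (T.v m) := fun h => by
  have h1 := T.theta_of_inside h
  rw [theta_vertex] at h1
  linarith [(T.ang_mem m).2, Real.pi_pos]

lemma theta_nonneg (V : ℂ) : 0 ≤ T.theta V := by
  by_cases h : T.Closed V
  · rcases T.closed_cases h with ⟨m, rfl⟩ | ⟨k, h⟩ | h
    · rw [theta_vertex]; exact (T.ang_mem m).1.le
    · rw [T.theta_of_onEdge h]; positivity
    · rw [T.theta_of_inside h]; positivity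
  · rw [T.theta_of_not_closed h]

lemma theta_pos_iff (V : ℂ) : 0 < T.theta V ↔ T.Closed V := by
  constructor
  · intro h
    by_contra hc
    rw [T.theta_of_not_closed hc] at h
    exact lt_irrefl _ h
  · intro h
    rcases T.closed_cases h with ⟨m, rfl⟩ | ⟨k, h⟩ | h
    · rw [theta_vertex]; exact (T.ang_mem m).1
    · rw [T.theta_of_onEdge h]; positivity
    · rw [T.theta_of_inside h]; positivity

end CTri

namespace IsCTiling

variable {ι : Type*} [Fintype ι] {T : ι → CTri} {W : CTri}

/-- The angles of the tiles at a point add up to the angle of the tiled triangle. -/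
theorem sum_theta (h : IsCTiling T W) (V : ℂ) : ∑ i, (T i).theta V = W.theta V := by
  unfold CTri.theta
  rw [← intervalIntegral.integral_finsetSum fun i _ => (T i).intervalIntegrable_sector V _ _]
  refine intervalIntegral.integral_congr fun φ _ => ?_
  exact h.sum_germ (cross_I_ne_zero (norm_exp_ofReal_mul_I φ))

end IsCTiling

/-! ### Additive invariants of tilings -/

/-- The coordinate of `V` in direction `u`. -/
def coord (V u : ℂ) : ℝ := V.re * u.re + V.im * u.im

lemma coord_neg (V u : ℂ) : coord V (-u) = -coord V u := by
  simp only [coord, neg_re, neg_im]; ring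

lemma coord_add_smul (V u : ℂ) (s : ℝ) (hu : ‖u‖ = 1) :
    coord (V + s * u) u = coord V u + s := by
  have hn : u.re * u.re + u.im * u.im = 1 := by
    rw [← normSq_apply, normSq_eq_norm_sq, hu]; norm_num
  simp only [coord, add_re, add_im, re_ofReal_mul, im_ofReal_mul]
  linear_combination s * hn

namespace CTri

variable (T : CTri)

lemma coord_tgt (k : Fin 3) :
    coord (T.v (k + 2)) (T.dir k) = coord (T.v (k + 1)) (T.dir k) + T.len k := by
  rw [tgt_eq, coord_add_smul _ _ _ (T.norm_dir k)]

/-- The sum over the edges of the product of a function of the direction and of a function of the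
length. -/
def edgeSum (f : ℝ →+ ℝ) (g : ℂ → ℤ) : ℝ := ∑ k, g (T.dir k) * f (T.len k)

/-- The edge sum of a triangle is obtained by integrating its edge balance. -/
lemma sum_edgeBalance (f : ℝ →+ ℝ) (g : ℂ → ℤ) (hg : ∀ u, g (-u) = -g u) (𝒱 𝒰 : Finset ℂ)
    (hV : ∀ k, T.v k ∈ 𝒱) (hU : ∀ k, T.dir k ∈ 𝒰 ∧ -T.dir k ∈ 𝒰) :
    ∑ V ∈ 𝒱, ∑ u ∈ 𝒰, g u * f (coord V u) * T.edgeBalance V u = -T.edgeSum f g := by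
  classical
  unfold edgeBalance edgeSum
  have e1 : ∀ V ∈ 𝒱, ∑ u ∈ 𝒰, g u * f (coord V u) *
      ((∑ k, ((if T.EdgeL k V u then 1 else 0) - (if T.EdgeR k V u then 1 else 0)) : ℤ) : ℝ) =
      ∑ k, g (T.dir k) * f (coord V (T.dir k)) *
        ((if V = T.v (k + 1) then 1 else 0) - (if V = T.v (k + 2) then 1 else 0)) := by
    intro V _
    push_cast
    simp_rw [Finset.mul_sum]
    rw [Finset.sum_comm]
    refine Finset.sum_congr rfl fun k _ => ?_
    have hl := T.len_pos k
    have hL : ∑ u ∈ 𝒰, g u * f (coord V u) * (if T.EdgeL k V u then (1 : ℝ) else 0) =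
        g (T.dir k) * f (coord V (T.dir k)) *
          (if T.EdgeL k V (T.dir k) then (1 : ℝ) else 0) := by
      refine Finset.sum_eq_single_of_mem _ (hU k).1 fun u _ hu => ?_
      rw [if_neg fun h => hu h.1.symm, mul_zero]
    have hR : ∑ u ∈ 𝒰, g u * f (coord V u) * (if T.EdgeR k V u then (1 : ℝ) else 0) =
        g (T.dir k) * f (coord V (T.dir k)) *
          (if T.EdgeR k V (-T.dir k) then (1 : ℝ) else 0) := by
      rw [Finset.sum_eq_single_of_mem _ (hU k).2 fun u _ hu => ?_]
      · rw [hg, coord_neg, map_neg]; push_cast; ring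
      · rw [if_neg fun h => hu (by rw [h.1, neg_neg]), mul_zero]
    simp_rw [mul_sub]
    rw [Finset.sum_sub_distrib, hL, hR, ← mul_sub, ← mul_sub]
    congr 1
    -- Inside an edge the contributions of its two directions cancel; the end points remain.
    have hk : ∀ k : Fin 3, k + 1 ≠ k + 2 := by decide
    have hne : T.v (k + 1) ≠ T.v (k + 2) := fun h => hk k (T.v_injective h)
    by_cases h1 : V = T.v (k + 1)
    · have a1 : T.EdgeL k V (T.dir k) := ⟨rfl, 0, le_rfl, hl, by simpa using h1⟩
      have a2 : ¬ T.EdgeR k V (-T.dir k) := by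
        rintro ⟨-, s, h2, -, h4⟩
        rw [h1] at h4
        have : (s : ℂ) * T.dir k = 0 := by simpa using h4
        rcases mul_eq_zero.mp this with h | h
        · exact h2.ne' (by exact_mod_cast h)
        · exact T.dir_ne_zero k h
      have a3 : V ≠ T.v (k + 2) := h1 ▸ hne
      rw [if_pos a1, if_neg a2, if_pos h1, if_neg a3]
    · by_cases h2 : V = T.v (k + 2)
      · have a2 : T.EdgeR k V (-T.dir k) := ⟨by simp, T.len k, hl, le_rfl, h2.trans (T.tgt_eq k)⟩
        have a1 : ¬ T.EdgeL k V (T.dir k) := by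
          rintro ⟨-, s, -, h3, h4⟩
          rw [h2, tgt_eq] at h4
          have : (T.len k : ℂ) * T.dir k = s * T.dir k := by simpa using h4
          have := mul_right_cancel₀ (T.dir_ne_zero k) this
          exact h3.ne' (by exact_mod_cast this)
        rw [if_neg h1, if_pos h2, if_neg a1, if_pos a2]
      · have : T.EdgeL k V (T.dir k) ↔ T.EdgeR k V (-T.dir k) := by
          constructor
          · rintro ⟨-, s, h3, h4, h5⟩
            refine ⟨by simp, s, lt_of_le_of_ne h3 ?_, h4.le, h5⟩
            rintro rfl
            exact h1 (by simpa using h5)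
          · rintro ⟨-, s, h3, h4, h5⟩
            refine ⟨rfl, s, h3.le, lt_of_le_of_ne h4 ?_, h5⟩
            rintro rfl
            exact h2 (h5.trans (T.tgt_eq k).symm)
        simp only [this, h1, h2, if_false, sub_self]
  rw [Finset.sum_congr rfl e1, Finset.sum_comm, ← Finset.sum_neg_distrib]
  refine Finset.sum_congr rfl fun k _ => ?_
  simp_rw [mul_sub, mul_ite, mul_one, mul_zero]
  rw [Finset.sum_sub_distrib, Finset.sum_ite_eq' 𝒱 (T.v (k + 1)), Finset.sum_ite_eq' 𝒱 (T.v (k + 2)),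
    if_pos (hV _), if_pos (hV _), coord_tgt, map_add]
  ring

end CTri

/-- **Additive invariance.** For an additive function of the length and an odd function of the
direction, the edge sums of the tiles add up to the edge sum of the tiled triangle. -/
theorem IsCTiling.sum_edgeSum {ι : Type*} [Fintype ι] {T : ι → CTri} {W : CTri}
    (h : IsCTiling T W) (f : ℝ →+ ℝ) (g : ℂ → ℤ) (hg : ∀ u, g (-u) = -g u) :
    ∑ i, (T i).edgeSum f g = W.edgeSum f g := by
  classical
  -- All vertices and all directions (with both signs) of the tiles and of the tiled triangle.
  let E : Finset (Option ι × Fin 3) := Finset.univ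
  let X : Option ι → CTri := fun o => o.elim W T
  let 𝒱 : Finset ℂ := E.image fun e => (X e.1).v e.2
  let 𝒰 : Finset ℂ := (E.image fun e => (X e.1).dir e.2) ∪ (E.image fun e => -(X e.1).dir e.2)
  have hV : ∀ o k, (X o).v k ∈ 𝒱 := fun o k =>
    Finset.mem_image.mpr ⟨(o, k), Finset.mem_univ _, rfl⟩
  have hU : ∀ o k, (X o).dir k ∈ 𝒰 ∧ -(X o).dir k ∈ 𝒰 := fun o k =>
    ⟨Finset.mem_union_left _ (Finset.mem_image.mpr ⟨(o, k), Finset.mem_univ _, rfl⟩),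
      Finset.mem_union_right _ (Finset.mem_image.mpr ⟨(o, k), Finset.mem_univ _, rfl⟩)⟩
  have hn : ∀ u ∈ 𝒰, ‖u‖ = 1 := by
    intro u hu
    rcases Finset.mem_union.mp hu with hu | hu <;> obtain ⟨e, -, rfl⟩ := Finset.mem_image.mp hu
    · exact (X e.1).norm_dir _
    · rw [norm_neg]; exact (X e.1).norm_dir _
  have hW := W.sum_edgeBalance f g hg 𝒱 𝒰 (hV none) (hU none)
  have hT := fun i => (T i).sum_edgeBalance f g hg 𝒱 𝒰 (hV (some i)) (hU (some i))
  apply neg_injective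
  rw [← hW, ← Finset.sum_neg_distrib, ← Finset.sum_congr rfl fun i _ => hT i, Finset.sum_comm]
  refine Finset.sum_congr rfl fun V _ => ?_
  rw [Finset.sum_comm]
  refine Finset.sum_congr rfl fun u hu => ?_
  rw [← Finset.mul_sum, ← h.edge_balance V (hn u hu)]
  push_cast
  rfl

/-! ### Sign characters on the directions -/

/-- A ccw triangle with side lengths `s` and opposite angles `θ`, up to a relabelling `lab` of the
vertices, which is the identity or the reflection `k ↦ -k` depending on the orientation. -/
structure IsTile (T : CTri) (s θ : Fin 3 → ℝ) (lab : Fin 3 → Fin 3) : Prop where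
  lab_eq : (∀ k, lab k = k) ∨ (∀ k, lab k = -k)
  len_eq : ∀ k, T.len k = s (lab k)
  ang_eq : ∀ k, T.ang k = θ (lab k)

/-- The rotation by the angle `k π / 3 + j β`. -/
def rot (β : ℝ) (k j : ℤ) : ℂ := exp ((k * (Real.pi / 3) + j * β : ℝ) * I)

lemma rot_mul (β : ℝ) (k j k' j' : ℤ) : rot β k j * rot β k' j' = rot β (k + k') (j + j') := by
  rw [rot, rot, rot, ← exp_add]
  congr 1
  push_cast
  ring

lemma rot_zero (β : ℝ) : rot β 0 0 = 1 := by simp [rot]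

/-- As `β` is not a rational multiple of `π`, the parity of `k` and the number `j` are determined by
the rotation. -/
lemma rot_inj {β : ℝ} (hβ : ∀ q : ℚ, β ≠ q * Real.pi) {k j k' j' : ℤ}
    (h : rot β k j = rot β k' j') : j = j' ∧ (6 : ℤ) ∣ k - k' := by
  obtain ⟨n, hn⟩ := exp_eq_exp_iff_exists_int.mp h
  have h1 : (k * (Real.pi / 3) + j * β : ℝ) = (k' * (Real.pi / 3) + j' * β) + n * (2 * Real.pi) := by
    have : ((k * (Real.pi / 3) + j * β : ℝ) : ℂ) * I =
        (((k' * (Real.pi / 3) + j' * β) + n * (2 * Real.pi) : ℝ) : ℂ) * I := by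
      rw [hn]; push_cast; ring
    exact_mod_cast mul_right_cancel₀ I_ne_zero this
  have hj : j = j' := by
    by_contra hne
    have hne : ((j - j' : ℤ) : ℝ) ≠ 0 := by exact_mod_cast sub_ne_zero.mpr hne
    apply hβ (((k' - k) / 3 + 2 * n) / (j - j' : ℤ))
    push_cast at hne ⊢
    field_simp
    linear_combination 3 * h1
  refine ⟨hj, n, ?_⟩
  subst hj
  have h2 : Real.pi * ((k : ℝ) - k' - 6 * n) = 0 := by linear_combination 3 * h1
  have h3 := (mul_eq_zero.mp h2).resolve_left Real.pi_ne_zero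
  have h4 : (k : ℝ) - k' = 6 * n := by linarith
  exact_mod_cast h4

open scoped Classical in
/-- The sign character on the directions `u₀ * rot β k j`, which takes the rotation by `π / 3` to
`-1` and the rotation by `β` to `σ`; it vanishes on all other directions. -/
def signChar (β : ℝ) (σ : ℤˣ) (u₀ u : ℂ) : ℤ :=
  if h : ∃ p : ℤ × ℤ, u = rot β p.1 p.2 * u₀ then (((-1) ^ h.choose.1 * σ ^ h.choose.2 : ℤˣ) : ℤ)
  else 0

lemma signChar_rot {β : ℝ} (hβ : ∀ q : ℚ, β ≠ q * Real.pi) (σ : ℤˣ) {u₀ : ℂ} (h0 : u₀ ≠ 0)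
    (k j : ℤ) : signChar β σ u₀ (rot β k j * u₀) = (((-1) ^ k * σ ^ j : ℤˣ) : ℤ) := by
  have h : ∃ p : ℤ × ℤ, rot β k j * u₀ = rot β p.1 p.2 * u₀ := ⟨(k, j), rfl⟩
  rw [signChar, dif_pos h]
  obtain ⟨h1, n, h2⟩ := rot_inj hβ (mul_right_cancel₀ h0 h.choose_spec)
  have h3 : k = h.choose.1 + 2 * (3 * n) := by linarith
  have h4 : ((-1 : ℤˣ)) ^ k = (-1) ^ h.choose.1 := by
    conv_lhs => rw [h3]
    rw [zpow_add, zpow_mul]; simp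
  rw [h4]
  congr 3
  exact h1.symm

lemma signChar_rot_mul {β : ℝ} (hβ : ∀ q : ℚ, β ≠ q * Real.pi) (σ : ℤˣ) {u₀ : ℂ} (h0 : u₀ ≠ 0)
    (k j : ℤ) (u : ℂ) :
    signChar β σ u₀ (rot β k j * u) = (((-1) ^ k * σ ^ j : ℤˣ) : ℤ) * signChar β σ u₀ u := by
  by_cases h : ∃ p : ℤ × ℤ, u = rot β p.1 p.2 * u₀
  · obtain ⟨⟨k', j'⟩, rfl⟩ := h
    rw [← mul_assoc, rot_mul, signChar_rot hβ σ h0, signChar_rot hβ σ h0, zpow_add, zpow_add]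
    push_cast
    ring
  · have h' : ¬ ∃ p : ℤ × ℤ, rot β k j * u = rot β p.1 p.2 * u₀ := by
      rintro ⟨p, hp⟩
      refine h ⟨(-k + p.1, -j + p.2), ?_⟩
      rw [← rot_mul, mul_assoc, ← hp, ← mul_assoc, rot_mul]
      simp [rot_zero]
    rw [signChar, dif_neg h', signChar, dif_neg h, mul_zero]

lemma signChar_neg {β : ℝ} (hβ : ∀ q : ℚ, β ≠ q * Real.pi) (σ : ℤˣ) {u₀ : ℂ} (h0 : u₀ ≠ 0)
    (u : ℂ) : signChar β σ u₀ (-u) = -signChar β σ u₀ u := by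
  have h := signChar_rot_mul hβ σ h0 3 0 u
  have h1 : rot β 3 0 = -1 := by
    rw [← exp_pi_mul_I, rot]; congr 1; push_cast; ring
  rw [h1, neg_one_mul] at h
  rw [h]
  have : ((-1 : ℤˣ)) ^ (3 : ℤ) = -1 := by decide
  simp [this]

lemma signChar_self {β : ℝ} (hβ : ∀ q : ℚ, β ≠ q * Real.pi) (σ : ℤˣ) {u₀ : ℂ} (h0 : u₀ ≠ 0) :
    signChar β σ u₀ u₀ = 1 := by
  have h := signChar_rot hβ σ h0 0 0
  simpa [rot_zero] using h

/-- The change of the sign character at a corner with angle `k π / 3 + j β`. -/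
lemma signChar_dir {β : ℝ} (hβ : ∀ q : ℚ, β ≠ q * Real.pi) (σ : ℤˣ) {u₀ : ℂ} (h0 : u₀ ≠ 0)
    (T : CTri) (m : Fin 3) (k j : ℤ) (ha : T.ang m = k * (Real.pi / 3) + j * β) :
    signChar β σ u₀ (T.dir (m + 1)) =
      -((((-1) ^ k * σ ^ j : ℤˣ) : ℤ) * signChar β σ u₀ (T.dir (m + 2))) := by
  rw [T.dir_succ, signChar_neg hβ σ h0, ← signChar_rot_mul hβ σ h0, rot, ha]

/-- The edge sum of a tile vanishes for the sign characters, if the additive function satisfies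
the corresponding linear relation. -/
lemma IsTile.edgeSum_eq_zero {T : CTri} {s θ : Fin 3 → ℝ} {lab : Fin 3 → Fin 3}
    (h : IsTile T s θ lab) (h2 : θ 2 = 2 * Real.pi / 3) (hsum : θ 0 + θ 1 = Real.pi / 3)
    (hβ : ∀ q : ℚ, θ 1 ≠ q * Real.pi) (σ : ℤˣ) {u₀ : ℂ} (h0 : u₀ ≠ 0) (f : ℝ →+ ℝ)
    (hf : f (s 0) - f (s 1) - (σ : ℤ) * f (s 2) = 0) :
    T.edgeSum f (signChar (θ 1) σ u₀) = 0 := by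
  have hσ : ((σ : ℤ) : ℝ) * σ = 1 := by
    rcases Int.units_eq_one_or σ with rfl | rfl <;> simp
  have c0 : ∀ m, lab m = 0 → T.ang m = ((1 : ℤ) : ℝ) * (Real.pi / 3) + ((-1 : ℤ) : ℝ) * θ 1 := by
    intro m hm; rw [h.ang_eq, hm]; push_cast; linarith
  have c2 : ∀ m, lab m = 2 → T.ang m = ((2 : ℤ) : ℝ) * (Real.pi / 3) + ((0 : ℤ) : ℝ) * θ 1 := by
    intro m hm; rw [h.ang_eq, hm, h2]; push_cast; ring
  have d0 : ∀ m, lab m = 0 → (signChar (θ 1) σ u₀ (T.dir (m + 1)) : ℝ) =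
      σ * signChar (θ 1) σ u₀ (T.dir (m + 2)) := by
    intro m hm
    have := signChar_dir hβ σ h0 T m _ _ (c0 m hm)
    have e : (((-1) ^ (1 : ℤ) * σ ^ (-1 : ℤ) : ℤˣ) : ℤ) = -σ := by
      rcases Int.units_eq_one_or σ with rfl | rfl <;> rfl
    rw [this, e]; push_cast; ring
  have d2 : ∀ m, lab m = 2 → (signChar (θ 1) σ u₀ (T.dir (m + 1)) : ℝ) =
      - signChar (θ 1) σ u₀ (T.dir (m + 2)) := by
    intro m hm
    have := signChar_dir hβ σ h0 T m _ _ (c2 m hm)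
    have e : (((-1) ^ (2 : ℤ) * σ ^ (0 : ℤ) : ℤˣ) : ℤ) = 1 := by
      rcases Int.units_eq_one_or σ with rfl | rfl <;> rfl
    rw [this, e]; push_cast; ring
  simp only [CTri.edgeSum, Fin.sum_univ_three, h.len_eq]
  rcases h.lab_eq with hl | hl
  · have e0 := d0 0 (hl 0)
    have e2 := d2 2 (hl 2)
    simp only [hl, Fin.isValue, zero_add, Fin.reduceAdd] at e0 e2 ⊢
    rw [e2, e0]
    linear_combination -(σ : ℝ) * signChar (θ 1) σ u₀ (T.dir 2) * hf -
      signChar (θ 1) σ u₀ (T.dir 2) * f (s 2) * hσ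
  · have e0 := d0 0 (hl 0)
    have e2 := d2 1 (hl 1)
    have n1 : (-1 : Fin 3) = 2 := by decide
    have n2 : (-2 : Fin 3) = 1 := by decide
    simp only [hl, Fin.isValue, zero_add, Fin.reduceAdd, neg_zero, n1, n2] at e0 e2 ⊢
    rw [e0] at *
    have e3 : (signChar (θ 1) σ u₀ (T.dir 0) : ℝ) = -signChar (θ 1) σ u₀ (T.dir 2) := by
      linarith
    rw [e3]
    linear_combination -(signChar (θ 1) σ u₀ (T.dir 2) : ℝ) * hf

/-- A real number on which all additive functions vanishing at `t` vanish is a rational multiple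
of `t`. -/
lemma exists_rat_of_forall_additive {t x : ℝ}
    (h : ∀ f : ℝ →ₗ[ℚ] ℚ, f t = 0 → f x = 0) : ∃ q : ℚ, x = q * t := by
  by_contra hx
  have hx' : x ∉ Submodule.span ℚ {t} := by
    rw [Submodule.mem_span_singleton]
    rintro ⟨q, hq⟩
    exact hx ⟨q, by rw [← hq, Rat.smul_def]⟩
  obtain ⟨f, h1, h2⟩ := Submodule.exists_le_ker_of_notMem hx'
  exact h1 (h f (h2 (Submodule.mem_span_singleton_self t)))

/-- The rationality constraint which a tiling imposes on the sides of the tiled triangle `W`, for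
each of the two sign characters. The `m`-th angle of `W` is `k m * (π / 3) + j m * β`. -/
theorem exists_rat_sum_sides {ι : Type*} [Fintype ι] {T : ι → CTri} {W : CTri}
    (h : IsCTiling T W) {s θ : Fin 3 → ℝ} {lab : ι → Fin 3 → Fin 3}
    (ht : ∀ i, IsTile (T i) s θ (lab i)) (h2 : θ 2 = 2 * Real.pi / 3)
    (hsum : θ 0 + θ 1 = Real.pi / 3) (hβ : ∀ q : ℚ, θ 1 ≠ q * Real.pi) (σ : ℤˣ)
    (k j : Fin 3 → ℤ) (hang : ∀ m, W.ang m = k m * (Real.pi / 3) + j m * θ 1)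
    (hk : ∑ m, k m = 3) (hj : ∑ m, j m = 0) :
    ∃ q : ℚ, ∑ m, ((((-1) ^ k m * σ ^ j m : ℤˣ) : ℤ) : ℝ) * W.len m =
      q * (s 0 - s 1 - (σ : ℤ) * s 2) := by
  refine exists_rat_of_forall_additive fun f hf => ?_
  have h0 := W.dir_ne_zero 0
  let F : ℝ →+ ℝ := (Rat.castHom ℝ).toAddMonoidHom.comp f.toAddMonoidHom
  have hFσ : ∀ (τ : ℤˣ) (x : ℝ), f ((τ : ℤ) * x) = (τ : ℤ) * f x := by
    intro τ x
    rcases Int.units_eq_one_or τ with rfl | rfl <;> simp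
  have hF : F (s 0) - F (s 1) - (σ : ℤ) * F (s 2) = 0 := by
    have : f (s 0) - f (s 1) - (σ : ℤ) * f (s 2) = 0 := by
      rw [← hFσ, ← map_sub, ← map_sub]; exact hf
    change ((f (s 0) : ℚ) : ℝ) - (f (s 1) : ℚ) - (σ : ℤ) * (f (s 2) : ℚ) = 0
    exact_mod_cast this
  have hS := h.sum_edgeSum F (signChar (θ 1) σ (W.dir 0)) (signChar_neg hβ σ h0)
  rw [Finset.sum_eq_zero fun i _ => (ht i).edgeSum_eq_zero h2 hsum hβ σ h0 F hF] at hS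
  have d := fun m => signChar_dir hβ σ h0 W m _ _ (hang m)
  have s0 := signChar_self hβ σ h0
  have d1 := d 1
  have d2 := d 2
  simp only [CTri.edgeSum, Fin.sum_univ_three] at hS
  simp only [Fin.isValue, Fin.reduceAdd, s0, mul_one] at d1 d2 hS
  have hFf : ∀ x, F x = ((f x : ℚ) : ℝ) := fun _ => rfl
  simp only [hFf] at hS
  rw [Fin.sum_univ_three] at hk hj ⊢
  -- The signs of the edges change by `-τ m` at the `m`-th corner. The product of these changes
  -- around the triangle is `1`.
  set τ : Fin 3 → ℤˣ := fun m => (-1) ^ k m * σ ^ j m with hτ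
  have hprod : τ 0 * τ 1 * τ 2 = -1 := by
    have : τ 0 * τ 1 * τ 2 = (-1) ^ (k 0 + k 1 + k 2) * σ ^ (j 0 + j 1 + j 2) := by
      simp only [hτ, zpow_add]
      simp only [mul_comm, mul_left_comm, mul_assoc]
    rw [this, hk, hj]; simp; decide
  change f ((τ 0 : ℤ) * W.len 0 + (τ 1 : ℤ) * W.len 1 + (τ 2 : ℤ) * W.len 2) = 0
  rw [map_add, map_add, hFσ, hFσ, hFσ]
  change _ = -((τ 1 : ℤ)) at d1
  change 1 = -((τ 2 : ℤ) * _) at d2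
  have e1 : signChar (θ 1) σ (W.dir 0) (W.dir 1) = -(τ 2 : ℤ) := by
    rcases Int.units_eq_one_or (τ 2) with h | h <;> rw [h] at d2 ⊢ <;> push_cast at d2 ⊢ <;> omega
  rw [d1, e1] at hS
  have hS' : (0 : ℚ) = f (W.len 0) + (-(τ 2 : ℤ) : ℤ) * f (W.len 1) +
      (-(τ 1 : ℤ) : ℤ) * f (W.len 2) := by
    rw [Int.cast_one, one_mul] at hS
    exact_mod_cast hS
  rcases Int.units_eq_one_or (τ 0) with h0 | h0 <;> rcases Int.units_eq_one_or (τ 1) with h1 | h1 <;>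
    rcases Int.units_eq_one_or (τ 2) with h2 | h2 <;> rw [h0, h1, h2] at hprod <;>
    first
    | (exact absurd hprod (by decide))
    | (rw [h1, h2] at hS'; rw [h0, h1, h2]; push_cast at hS' ⊢; linarith)

/-! ### The side ratios of the tiled triangle -/

/-- For a triangle with sides `a`, `b`, `c` and angles `α`, `β`, `2π/3`, the sine of
`p * α + q * β` is proportional to this number (for those pairs `p, q` which occur for the angles of
a triangle). -/
def sineNum (a b c : ℝ) : ℕ → ℕ → ℝ
  | 1, 0 => a * c ^ 2
  | 0, 1 => b * c ^ 2
  | 1, 1 => c ^ 3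
  | 1, 2 => (a + b) * c ^ 2
  | 2, 1 => (a + b) * c ^ 2
  | 2, 0 => a * (2 * b + a) * c
  | 1, 3 => a * (2 * b + a) * c
  | 0, 2 => b * (2 * a + b) * c
  | 3, 1 => b * (2 * a + b) * c
  | 3, 0 => 3 * a * b * (a + b)
  | 0, 3 => 3 * a * b * (a + b)
  | _, _ => 0

/-- All these sines follow from `sin α`, `sin β`, and `sin (π / 3)`, which are proportional to `a`,
`b`, and `c`. -/
lemma sin_mul_add_mul {a b c t α β : ℝ} (ht : 0 < t) (hαβ : α + β = Real.pi / 3)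
    (ha' : Real.sin α = t * a) (hb' : Real.sin β = t * b) (hc' : Real.sin (2 * Real.pi / 3) = t * c)
    (habc : c ^ 2 = a ^ 2 + a * b + b ^ 2) {p q : ℕ}
    (hpq : (p, q) ∈ [(1, 0), (0, 1), (1, 1), (1, 2), (2, 1), (2, 0), (1, 3), (0, 2), (3, 1), (3, 0),
      (0, 3)]) :
    Real.sin (p * α + q * β) * c ^ 2 = t * sineNum a b c p q := by
  have h3 : Real.sqrt 3 ^ 2 = 3 := Real.sq_sqrt (by norm_num)
  have hc2 : Real.sqrt 3 / 2 = t * c := by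
    rw [← hc', show 2 * Real.pi / 3 = Real.pi - Real.pi / 3 by ring, Real.sin_pi_sub,
      Real.sin_pi_div_three]
  have hcα : Real.cos α * c = b + a / 2 := by
    have h1 : Real.sin (Real.pi / 3 - α) = t * b := by rw [← hb', ← hαβ]; ring_nf
    rw [Real.sin_sub, Real.sin_pi_div_three, Real.cos_pi_div_three, ha', hc2] at h1
    apply mul_left_cancel₀ ht.ne'
    linear_combination h1
  have hcβ : Real.cos β * c = a + b / 2 := by
    have h1 : Real.sin (Real.pi / 3 - β) = t * a := by rw [← ha', ← hαβ]; ring_nf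
    rw [Real.sin_sub, Real.sin_pi_div_three, Real.cos_pi_div_three, hb', hc2] at h1
    apply mul_left_cancel₀ ht.ne'
    linear_combination h1
  have ht2 : 4 * (t ^ 2 * c ^ 2) = 3 := by
    have : (Real.sqrt 3 / 2) ^ 2 = t ^ 2 * c ^ 2 := by rw [hc2]; ring
    linarith
  have hβ : β = Real.pi / 3 - α := by linarith
  have s2α : Real.sin (2 * α) * c ^ 2 = t * (a * (2 * b + a) * c) := by
    rw [Real.sin_two_mul, ha']
    linear_combination 2 * t * a * c * hcα
  have s2β : Real.sin (2 * β) * c ^ 2 = t * (b * (2 * a + b) * c) := by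
    rw [Real.sin_two_mul, hb']
    linear_combination 2 * t * b * c * hcβ
  have s21 : Real.sin (2 * α + β) * c ^ 2 = t * ((a + b) * c ^ 2) := by
    have : 2 * α + β = Real.pi / 3 + α := by linarith
    rw [this, Real.sin_add, Real.sin_pi_div_three, Real.cos_pi_div_three, ha', hc2]
    linear_combination t * c ^ 2 * hcα
  have s3 : Real.sin (3 * α) * c ^ 2 = t * (3 * a * b * (a + b)) := by
    rw [Real.sin_three_mul, ha']
    linear_combination 3 * t * a * habc - t * a ^ 3 * ht2
  simp only [List.mem_cons, Prod.mk.injEq, List.not_mem_nil, or_false] at hpq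
  rcases hpq with ⟨rfl, rfl⟩ | ⟨rfl, rfl⟩ | ⟨rfl, rfl⟩ | ⟨rfl, rfl⟩ | ⟨rfl, rfl⟩ | ⟨rfl, rfl⟩ |
    ⟨rfl, rfl⟩ | ⟨rfl, rfl⟩ | ⟨rfl, rfl⟩ | ⟨rfl, rfl⟩ | ⟨rfl, rfl⟩ <;>
    simp only [sineNum, Nat.cast_zero, Nat.cast_one, Nat.cast_ofNat, zero_mul, one_mul, add_zero,
      zero_add]
  · rw [ha']; ring
  · rw [hb']; ring
  · rw [hαβ, Real.sin_pi_div_three, hc2]; ring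
  · rw [show α + 2 * β = Real.pi - (2 * α + β) by linarith, Real.sin_pi_sub, s21]
  · exact s21
  · exact s2α
  · rw [show α + 3 * β = Real.pi - 2 * α by linarith, Real.sin_pi_sub, s2α]
  · exact s2β
  · rw [show 3 * α + β = Real.pi - 2 * β by linarith, Real.sin_pi_sub, s2β]
  · exact s3
  · rw [show 3 * β = Real.pi - 3 * α by linarith, Real.sin_pi_sub, s3]

/-- The two rationality constraints together force `c` to be a rational multiple of `l`, if the
two signed perimeters are related by the factor `(c + l) / (c - l)`. -/
lemma exists_rat_mul {a b c X Y κ l ε : ℝ} {r r' : ℚ} (ha : 0 < a) (hb : 0 < b)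
    (habc : c ^ 2 = a ^ 2 + a * b + b ^ 2) (hX0 : κ * X ≠ 0) (hl : l ≠ 0)
    (hX : κ * X = r * (a - b - c)) (hY : κ * Y = r' * (a - b + c)) (hε : ε = 1 ∨ ε = -1)
    (h : X * (a - b + c) * (c - l) = ε * Y * (a - b - c) * (c + l)) :
    ∃ q : ℚ, c = q * l := by
  have hab : (a - b - c) * (a - b + c) ≠ 0 := by
    have : (a - b - c) * (a - b + c) = -(3 * a * b) := by linear_combination -habc
    rw [this]
    exact neg_ne_zero.mpr (by positivity)
  have h1 : r * (c - l) = ε * r' * (c + l) := by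
    apply mul_left_cancel₀ hab
    linear_combination κ * h - (a - b + c) * (c - l) * hX + ε * (a - b - c) * (c + l) * hY
  have hr : (r : ℝ) ≠ 0 := by
    rintro h
    rw [hX, h, zero_mul] at hX0
    exact hX0 rfl
  rcases hε with rfl | rfl
  · have h2 : (r : ℝ) - r' ≠ 0 := by
      intro h2
      have : 2 * r * l = 0 := by linear_combination -h1 + (c + l) * h2
      simp [hr, hl] at this
    refine ⟨(r + r') / (r - r'), ?_⟩
    push_cast
    field_simp
    linear_combination h1
  · have h2 : (r : ℝ) + r' ≠ 0 := by
      intro h2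
      have : 2 * r * l = 0 := by linear_combination -h1 + (c + l) * h2
      simp [hr, hl] at this
    refine ⟨(r - r') / (r + r'), ?_⟩
    push_cast
    field_simp
    linear_combination h1

/-- `exists_rat_linear` for corners ordered by the multiplicity of `α`. -/
lemma exists_rat_linear_of_sorted {a b c κ : ℝ} (ha : 0 < a) (hb : 0 < b) (hne : a ≠ b)
    (habc : c ^ 2 = a ^ 2 + a * b + b ^ 2) {p₀ p₁ p₂ q₀ q₁ q₂ : ℕ} (hp : p₀ + p₁ + p₂ = 3)
    (hq : q₀ + q₁ + q₂ = 3) (h01 : p₁ ≤ p₀) (h12 : p₂ ≤ p₁) (z₀ : p₀ + q₀ ≠ 0) (z₁ : p₁ + q₁ ≠ 0)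
    (z₂ : p₂ + q₂ ≠ 0) (hsim : ¬(p₀ = 2 ∧ q₀ = 2)) {L₀ L₁ L₂ : ℝ}
    (hL₀ : L₀ = κ * sineNum a b c p₀ q₀) (hL₁ : L₁ = κ * sineNum a b c p₁ q₁)
    (hL₂ : L₂ = κ * sineNum a b c p₂ q₂) (t₀ : L₀ < L₁ + L₂) (t₁ : L₁ < L₂ + L₀)
    (t₂ : L₂ < L₀ + L₁) {r r' : ℚ}
    (hX : (-1) ^ p₀ * L₀ + (-1) ^ p₁ * L₁ + (-1) ^ p₂ * L₂ = r * (a - b - c))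
    (hY : (-1) ^ q₀ * L₀ + (-1) ^ q₁ * L₁ + (-1) ^ q₂ * L₂ = r' * (a - b + c)) :
    ∃ u v : ℚ, c = u * a + v * b := by
  -- A signed sum of the sides of a triangle does not vanish.
  have hX0 : (-1 : ℝ) ^ p₀ * L₀ + (-1) ^ p₁ * L₁ + (-1) ^ p₂ * L₂ ≠ 0 := by
    rcases neg_one_pow_eq_or ℝ p₀ with h | h <;> rcases neg_one_pow_eq_or ℝ p₁ with h' | h' <;>
      rcases neg_one_pow_eq_or ℝ p₂ with h'' | h'' <;> rw [h, h', h''] <;> intro h0 <;> linarith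
  have key : ∀ (ε l : ℝ) (u v : ℚ), l = u * a + v * b → l ≠ 0 → (ε = 1 ∨ ε = -1) →
      ((-1) ^ p₀ * sineNum a b c p₀ q₀ + (-1) ^ p₁ * sineNum a b c p₁ q₁ +
        (-1) ^ p₂ * sineNum a b c p₂ q₂) * (a - b + c) * (c - l) =
      ε * ((-1) ^ q₀ * sineNum a b c p₀ q₀ + (-1) ^ q₁ * sineNum a b c p₁ q₁ +
        (-1) ^ q₂ * sineNum a b c p₂ q₂) * (a - b - c) * (c + l) →
      ∃ u v : ℚ, c = u * a + v * b := by
    intro ε l u v hl hl0 hε h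
    have e : ∀ x y z : ℝ, x * L₀ + y * L₁ + z * L₂ = κ * (x * sineNum a b c p₀ q₀ +
        y * sineNum a b c p₁ q₁ + z * sineNum a b c p₂ q₂) := by
      intro x y z; rw [hL₀, hL₁, hL₂]; ring
    rw [e] at hX hY hX0
    obtain ⟨q, hq⟩ := exists_rat_mul ha hb habc hX0 hl0 hX hY hε h
    refine ⟨q * u, q * v, ?_⟩
    rw [hq, hl]; push_cast; ring
  have hab : a - b ≠ 0 := sub_ne_zero.mpr hne
  -- In each case the quotient of the signed sums has the form `± (c + l) / (c - l)` for one of these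
  -- values of `l`, up to the factor `(a - b - c) / (a - b + c)`.
  have A := key 1 a 1 0 (by push_cast; ring) ha.ne' (Or.inl rfl)
  have A' := key (-1) a 1 0 (by push_cast; ring) ha.ne' (Or.inr rfl)
  have B := key 1 (-b) 0 (-1) (by push_cast; ring) (neg_ne_zero.mpr hb.ne') (Or.inl rfl)
  have B' := key (-1) (-b) 0 (-1) (by push_cast; ring) (neg_ne_zero.mpr hb.ne') (Or.inr rfl)
  have C := key (-1) (a + b) 1 1 (by push_cast; ring) (by positivity) (Or.inr rfl)
  have C' := key (-1) (-(a + b)) (-1) (-1) (by push_cast; ring)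
    (neg_ne_zero.mpr (by positivity)) (Or.inr rfl)
  have D := key (-1) (a - b) 1 (-1) (by push_cast; ring) hab (Or.inr rfl)
  have E := key 1 (2 * a + b) 2 1 (by push_cast; ring) (by positivity) (Or.inl rfl)
  have E' := key 1 (-(a + 2 * b)) (-1) (-2) (by push_cast; ring)
    (neg_ne_zero.mpr (by positivity)) (Or.inl rfl)
  clear key
  have hcase : (p₀ = 1 ∧ p₁ = 1 ∧ p₂ = 1) ∨ (p₀ = 2 ∧ p₁ = 1 ∧ p₂ = 0) ∨
      (p₀ = 3 ∧ p₁ = 0 ∧ p₂ = 0) := by omega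
  have hq₀ : q₀ ≤ 3 := by omega
  have hq₁ : q₁ ≤ 3 := by omega
  obtain rfl : q₂ = 3 - q₀ - q₁ := by omega
  rcases hcase with ⟨rfl, rfl, rfl⟩ | ⟨rfl, rfl, rfl⟩ | ⟨rfl, rfl, rfl⟩
  · interval_cases q₀ <;> interval_cases q₁ <;> first | (exfalso; omega) | skip
    · exact C (by clear * - habc; simp only [sineNum]; grind)
    · exact A (by clear * - habc; simp only [sineNum]; grind)
    · exact A (by clear * - habc; simp only [sineNum]; grind)
    · exact C (by clear * - habc; simp only [sineNum]; grind)
    · exact A (by clear * - habc; simp only [sineNum]; grind)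
    · exact D (by clear * - habc; simp only [sineNum]; grind)
    · exact A (by clear * - habc; simp only [sineNum]; grind)
    · exact A (by clear * - habc; simp only [sineNum]; grind)
    · exact A (by clear * - habc; simp only [sineNum]; grind)
    · exact C (by clear * - habc; simp only [sineNum]; grind)
  · interval_cases q₀ <;> interval_cases q₁ <;> first | (exfalso; omega) | skip
    · exact E (by clear * - habc; simp only [sineNum]; grind)
    · exact D (by clear * - habc; simp only [sineNum]; grind)
    · exact B' (by clear * - habc; simp only [sineNum]; grind)
    · exact A' (by clear * - habc; simp only [sineNum]; grind)
    · exact B (by clear * - habc; simp only [sineNum]; grind)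
  · interval_cases q₀ <;> interval_cases q₁ <;> first | (exfalso; omega) | skip
    · exact E' (by clear * - habc; simp only [sineNum]; grind)
    · exact E' (by clear * - habc; simp only [sineNum]; grind)
    · exact C' (by clear * - habc; simp only [sineNum]; grind)

/-- If the angles of a triangle with sides `L` are `p m * α + q m * β` and if it satisfies the
rationality constraints for both sign characters, then `c` is a rational linear combination of
`a` and `b`. -/
lemma exists_rat_linear {a b c κ : ℝ} (ha : 0 < a) (hb : 0 < b) (hne : a ≠ b)
    (habc : c ^ 2 = a ^ 2 + a * b + b ^ 2) {p q : Fin 3 → ℕ} (hp : ∑ m, p m = 3)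
    (hq : ∑ m, q m = 3) (hz : ∀ m, p m + q m ≠ 0) (hsim : ∀ m, ¬(p m = 2 ∧ q m = 2))
    {L : Fin 3 → ℝ} (hL : ∀ m, L m = κ * sineNum a b c (p m) (q m))
    (ht : ∀ m, L m < L (m + 1) + L (m + 2)) {r r' : ℚ}
    (hX : ∑ m, (-1) ^ p m * L m = r * (a - b - c))
    (hY : ∑ m, (-1) ^ q m * L m = r' * (a - b + c)) :
    ∃ u v : ℚ, c = u * a + v * b := by
  rw [Fin.sum_univ_three] at hp hq hX hY
  have t0 := ht 0
  have t1 := ht 1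
  have t2 := ht 2
  simp only [Fin.isValue, Fin.reduceAdd] at t0 t1 t2
  have key : ∀ i j k : Fin 3, p i + p j + p k = 3 → q i + q j + q k = 3 → p j ≤ p i → p k ≤ p j →
      L i < L j + L k → L j < L k + L i → L k < L i + L j →
      (-1) ^ p i * L i + (-1) ^ p j * L j + (-1) ^ p k * L k = r * (a - b - c) →
      (-1) ^ q i * L i + (-1) ^ q j * L j + (-1) ^ q k * L k = r' * (a - b + c) →
      ∃ u v : ℚ, c = u * a + v * b :=
    fun i j k h1 h2 h3 h4 h5 h6 h7 h8 h9 =>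
      exists_rat_linear_of_sorted ha hb hne habc h1 h2 h3 h4 (hz i) (hz j) (hz k) (hsim i)
        (hL i) (hL j) (hL k) h5 h6 h7 h8 h9
  rcases le_total (p 0) (p 1) with h01 | h01 <;> rcases le_total (p 1) (p 2) with h12 | h12 <;>
    rcases le_total (p 0) (p 2) with h02 | h02
  · apply key 2 1 0 <;> first | omega | linarith
  · apply key 2 1 0 <;> first | omega | linarith
  · apply key 1 2 0 <;> first | omega | linarith
  · apply key 1 0 2 <;> first | omega | linarith
  · apply key 2 0 1 <;> first | omega | linarith
  · apply key 0 2 1 <;> first | omega | linarith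
  · exact key 0 1 2 hp hq h01 h12 t0 t1 t2 hX hY
  · exact key 0 1 2 hp hq h01 h12 t0 t1 t2 hX hY

/-! ### Edges meeting at a vertex of the tiling -/

namespace CTri

lemma lam_eq_zero_of_edgeL {T : CTri} {k : Fin 3} {V u : ℂ} (h : T.EdgeL k V u) :
    T.lam k V = 0 := by
  obtain ⟨-, s, -, -, rfl⟩ := h
  exact (T.lam_on_edge k s).1

lemma lam_eq_zero_of_edgeR {T : CTri} {k : Fin 3} {V u : ℂ} (h : T.EdgeR k V u) :
    T.lam k V = 0 := by
  obtain ⟨-, s, -, -, rfl⟩ := h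
  exact (T.lam_on_edge k s).1

lemma edgeL_iff (T : CTri) {k : Fin 3} {V u : ℂ} :
    T.EdgeL k V u ↔ T.dir k = u ∧ (T.v (k + 1) = V ∨ T.OnEdge k V) := by
  refine and_congr_right fun _ => ⟨?_, ?_⟩
  · rintro ⟨s, h0, h1, h2⟩
    rcases h0.eq_or_lt with rfl | h0
    · left; simpa using h2.symm
    · exact Or.inr ⟨s, h0, h1, h2⟩
  · rintro (rfl | ⟨s, h0, h1, h2⟩)
    · exact ⟨0, le_rfl, T.len_pos k, by simp⟩
    · exact ⟨s, h0.le, h1, h2⟩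

lemma edgeR_iff (T : CTri) {k : Fin 3} {V u : ℂ} :
    T.EdgeR k V u ↔ T.dir k = -u ∧ (T.v (k + 2) = V ∨ T.OnEdge k V) := by
  refine and_congr_right fun _ => ⟨?_, ?_⟩
  · rintro ⟨s, h0, h1, h2⟩
    rcases h1.eq_or_lt with rfl | h1
    · left; rw [h2, tgt_eq]
    · exact Or.inr ⟨s, h0, h1, h2⟩
  · rintro (rfl | ⟨s, h0, h1, h2⟩)
    · exact ⟨T.len k, T.len_pos k, le_rfl, T.tgt_eq k⟩
    · exact ⟨s, h0, h1.le, h2⟩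

lemma edgeBalance_of_inside (T : CTri) {V : ℂ} (h : T.Inside V) (u : ℂ) :
    T.edgeBalance V u = 0 := by
  classical
  refine Finset.sum_eq_zero fun k _ => ?_
  rw [if_neg fun h' => (h k).ne' (lam_eq_zero_of_edgeL h'),
    if_neg fun h' => (h k).ne' (lam_eq_zero_of_edgeR h'), sub_self]

lemma theta_le (T : CTri) (V : ℂ) : T.theta V ≤ 2 * Real.pi := by
  have := Real.pi_pos
  by_cases h : T.Closed V
  · rcases T.closed_cases h with ⟨m, rfl⟩ | ⟨k, h⟩ | h
    · rw [theta_vertex]; linarith [(T.ang_mem m).2]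
    · rw [T.theta_of_onEdge h]; linarith
    · rw [T.theta_of_inside h]
  · rw [T.theta_of_not_closed h]; linarith

lemma theta_eq_sum (T : CTri) {V : ℂ} (hno : ¬ T.Inside V)
    (hnoe : ∀ k, ¬ T.OnEdge k V) [DecidableEq ℂ] :
    T.theta V = ∑ k, if T.v k = V then T.ang k else 0 := by
  by_cases h : T.Closed V
  · rcases T.closed_cases h with ⟨m, rfl⟩ | ⟨k, h⟩ | h
    · rw [T.theta_vertex, Finset.sum_eq_single_of_mem m (Finset.mem_univ _)]
      · simp
      · intro k _ hk
        rw [if_neg fun h => hk (T.v_injective h)]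
    · exact absurd h (hnoe k)
    · exact absurd h hno
  · rw [T.theta_of_not_closed h, Finset.sum_eq_zero]
    intro k _
    rw [if_neg]
    rintro rfl
    exact h (T.closed_vertex k)

end CTri

section Edges

variable {ι : Type*}

/-- The starting point of an edge of a tile, traversed counterclockwise. -/
def src (T : ι → CTri) (e : ι × Fin 3) : ℂ := (T e.1).v (e.2 + 1)

/-- The end point of an edge of a tile, traversed counterclockwise. -/
def tgt (T : ι → CTri) (e : ι × Fin 3) : ℂ := (T e.1).v (e.2 + 2)

/-- The direction of an edge of a tile, traversed counterclockwise. -/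
def edir (T : ι → CTri) (e : ι × Fin 3) : ℂ := (T e.1).dir e.2

/-- The point `V` lies in the relative interior of the edge `e`. -/
def On (T : ι → CTri) (e : ι × Fin 3) (V : ℂ) : Prop := (T e.1).OnEdge e.2 V

end Edges

namespace IsCTiling

lemma closed_of_vertex {ι : Type*} {T : ι → CTri} {W : CTri} (h : IsCTiling T W) (c : ι × Fin 3) : W.Closed ((T c.1).v c.2) :=
  (h.cover _).mp ⟨c.1, (T c.1).closed_vertex _⟩

variable {ι : Type*} [Fintype ι] {T : ι → CTri} {W : CTri}

lemma left_unique (h : IsCTiling T W) {e e' : ι × Fin 3} {V : ℂ} (hd : edir T e = edir T e')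
    (h1 : src T e = V ∨ On T e V) (h2 : src T e' = V ∨ On T e' V) : e = e' := by
  have := h.edgeL_unique ((T e.1).edgeL_iff.mpr ⟨hd, h1⟩) ((T e'.1).edgeL_iff.mpr ⟨rfl, h2⟩)
  exact Prod.ext this.1 this.2

lemma right_unique (h : IsCTiling T W) {e e' : ι × Fin 3} {V : ℂ} (hd : edir T e = edir T e')
    (h1 : tgt T e = V ∨ On T e V) (h2 : tgt T e' = V ∨ On T e' V) : e = e' := by
  have := h.edgeR_unique (u := -edir T e') ((T e.1).edgeR_iff.mpr ⟨by rw [neg_neg]; exact hd, h1⟩)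
    ((T e'.1).edgeR_iff.mpr ⟨by rw [neg_neg]; rfl, h2⟩)
  exact Prod.ext this.1 this.2

lemma exists_right_of_left (h : IsCTiling T W) {V : ℂ} (hV : W.Inside V) {e : ι × Fin 3}
    (h1 : src T e = V ∨ On T e V) :
    ∃ e', edir T e' = -edir T e ∧ (tgt T e' = V ∨ On T e' V) := by
  classical
  have hL : (T e.1).EdgeL e.2 V (edir T e) := (T e.1).edgeL_iff.mpr ⟨rfl, h1⟩
  by_contra hno
  have hR : ∀ i k, ¬ (T i).EdgeR k V (edir T e) := fun i k hR =>
    hno ⟨(i, k), (T i).edgeR_iff.mp hR⟩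
  have hb := h.edge_balance V (u := edir T e) ((T e.1).norm_dir _)
  rw [W.edgeBalance_of_inside hV] at hb
  simp only [CTri.edgeBalance, hR, if_false, sub_zero] at hb
  rw [Finset.sum_eq_zero_iff_of_nonneg
    fun i _ => Finset.sum_nonneg fun k _ => by split_ifs <;> norm_num] at hb
  have h2 := (Finset.sum_eq_zero_iff_of_nonneg fun k _ => by split_ifs <;> norm_num).mp
    (hb e.1 (Finset.mem_univ _)) e.2 (Finset.mem_univ _)
  rw [if_pos hL] at h2
  exact one_ne_zero h2

lemma exists_left_of_right (h : IsCTiling T W) {V : ℂ} (hV : W.Inside V) {e : ι × Fin 3}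
    (h1 : tgt T e = V ∨ On T e V) :
    ∃ e', edir T e' = -edir T e ∧ (src T e' = V ∨ On T e' V) := by
  classical
  have hR : (T e.1).EdgeR e.2 V (-edir T e) :=
    (T e.1).edgeR_iff.mpr ⟨by rw [neg_neg]; rfl, h1⟩
  by_contra hno
  have hL : ∀ i k, ¬ (T i).EdgeL k V (-edir T e) := fun i k hL =>
    hno ⟨(i, k), (T i).edgeL_iff.mp hL⟩
  have hb := h.edge_balance V (u := -edir T e) (by rw [norm_neg]; exact (T e.1).norm_dir _)
  rw [W.edgeBalance_of_inside hV, ← neg_eq_zero] at hb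
  simp only [CTri.edgeBalance, hL, if_false, zero_sub, Finset.sum_neg_distrib, neg_neg] at hb
  rw [Finset.sum_eq_zero_iff_of_nonneg
    fun i _ => Finset.sum_nonneg fun k _ => by split_ifs <;> norm_num] at hb
  have h2 := (Finset.sum_eq_zero_iff_of_nonneg fun k _ => by split_ifs <;> norm_num).mp
    (hb e.1 (Finset.mem_univ _)) e.2 (Finset.mem_univ _)
  rw [if_pos hR] at h2
  exact one_ne_zero h2

lemma sum_theta_le (h : IsCTiling T W) (V : ℂ) (S : Finset ι) :
    ∑ i ∈ S, (T i).theta V ≤ W.theta V := by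
  rw [← h.sum_theta]
  exact Finset.sum_le_sum_of_subset_of_nonneg (Finset.subset_univ _)
    fun i _ _ => (T i).theta_nonneg V

/-- A vertex of a tile which lies in the relative interior of an edge of another tile is an
interior point of the tiled triangle. -/
lemma inside_of_on (h : IsCTiling T W) {V : ℂ} {e c : ι × Fin 3} (he : On T e V)
    (hc : (T c.1).v c.2 = V) : W.Inside V := by
  classical
  have hne : e.1 ≠ c.1 := by
    rintro heq
    rw [On, heq, ← hc] at he
    exact (T c.1).not_onEdge_vertex _ _ he
  have hs := h.sum_theta_le V {e.1, c.1}
  have hp := ((T c.1).theta_pos_iff (T c.1 |>.v c.2)).mpr ((T c.1).closed_vertex c.2)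
  rw [Finset.sum_pair hne, (T e.1).theta_of_onEdge he, ← hc] at hs
  rw [← hc]
  have hW : W.Closed ((T c.1).v c.2) := (W.theta_pos_iff _).mp (by linarith [Real.pi_pos])
  rcases W.closed_cases hW with ⟨m, hm⟩ | ⟨k, hk⟩ | hi
  · rw [← hm, W.theta_vertex, hm] at hs
    linarith [(W.ang_mem m).2]
  · rw [W.theta_of_onEdge hk] at hs
    linarith
  · exact hi

/-- A vertex of a tile lies in the relative interior of at most one edge. -/
lemma on_unique (h : IsCTiling T W) {V : ℂ} {e e' c : ι × Fin 3} (he : On T e V)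
    (he' : On T e' V) (hc : (T c.1).v c.2 = V) : e = e' := by
  classical
  have hne : e.1 ≠ c.1 := by
    rintro heq
    rw [On, heq, ← hc] at he
    exact (T c.1).not_onEdge_vertex _ _ he
  have hne' : e'.1 ≠ c.1 := by
    rintro heq
    rw [On, heq, ← hc] at he'
    exact (T c.1).not_onEdge_vertex _ _ he'
  have hp := ((T c.1).theta_pos_iff (T c.1 |>.v c.2)).mpr ((T c.1).closed_vertex c.2)
  by_cases hee : e.1 = e'.1
  · refine Prod.ext hee ?_
    rw [On, hee] at he
    exact he.unique he'
  · have hs := h.sum_theta_le V {e.1, e'.1, c.1}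
    rw [Finset.sum_insert (by simp [hne, hee]), Finset.sum_pair hne',
      (T e.1).theta_of_onEdge he, (T e'.1).theta_of_onEdge he'] at hs
    have := W.theta_le V
    rw [hc] at hp
    linarith

lemma not_inside_of_vertex (h : IsCTiling T W) {V : ℂ} {c : ι × Fin 3}
    (hc : (T c.1).v c.2 = V) (i : ι) : ¬ (T i).Inside V := by
  classical
  intro hi
  have hne : i ≠ c.1 := by
    rintro rfl
    rw [← hc] at hi
    exact (T c.1).not_inside_vertex _ hi
  have hp := ((T c.1).theta_pos_iff (T c.1 |>.v c.2)).mpr ((T c.1).closed_vertex c.2)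
  have hs := h.sum_theta_le V {i, c.1}
  rw [Finset.sum_pair hne, (T i).theta_of_inside hi] at hs
  have := W.theta_le V
  rw [hc] at hp
  linarith

open scoped Classical in
/-- The tile corners located at the point `V`. -/
def cornersAt (T : ι → CTri) (V : ℂ) : Finset (ι × Fin 3) := {c | (T c.1).v c.2 = V}

/-- The corners at a vertex of the tiling fill the angle of the tiled triangle, if the vertex does
not lie on an edge of another tile. -/
lemma sum_ang_cornersAt (h : IsCTiling T W) {V : ℂ} (hV : (cornersAt T V).Nonempty)
    (hno : ∀ e, ¬ On T e V) : ∑ c ∈ cornersAt T V, (T c.1).ang c.2 = W.theta V := by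
  classical
  obtain ⟨c, hc⟩ := hV
  have hc : (T c.1).v c.2 = V := by simpa [cornersAt] using hc
  rw [← h.sum_theta, cornersAt, Finset.sum_filter, ← Finset.univ_product_univ,
    Finset.sum_product]
  refine Finset.sum_congr rfl fun i _ => ?_
  rw [(T i).theta_eq_sum (h.not_inside_of_vertex hc i) fun k hk => hno (i, k) hk]

/-- The corners at a vertex of the tiling inside an edge of another tile add up to `π`. -/
lemma sum_ang_cornersAt_of_on (h : IsCTiling T W) {V : ℂ} (hV : (cornersAt T V).Nonempty)
    {e : ι × Fin 3} (he : On T e V) : ∑ c ∈ cornersAt T V, (T c.1).ang c.2 = Real.pi := by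
  classical
  obtain ⟨c, hc⟩ := hV
  have hc : (T c.1).v c.2 = V := by simpa [cornersAt] using hc
  have hs := h.sum_theta V
  rw [W.theta_of_inside (h.inside_of_on he hc), ← Finset.add_sum_erase _ _ (Finset.mem_univ e.1),
    (T e.1).theta_of_onEdge he] at hs
  have he0 : ∑ k, (if (T e.1).v k = V then (T e.1).ang k else 0) = 0 := by
    refine Finset.sum_eq_zero fun k _ => if_neg ?_
    rintro rfl
    exact (T e.1).not_onEdge_vertex _ _ he
  rw [cornersAt, Finset.sum_filter, ← Finset.univ_product_univ, Finset.sum_product,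
    ← Finset.add_sum_erase _ _ (Finset.mem_univ e.1), he0]
  have : ∑ i ∈ Finset.univ.erase e.1, (T i).theta V =
      ∑ i ∈ Finset.univ.erase e.1, ∑ k, if (T i).v k = V then (T i).ang k else 0 := by
    refine Finset.sum_congr rfl fun i hi => ?_
    refine (T i).theta_eq_sum (h.not_inside_of_vertex hc i) fun k hk => ?_
    have := h.on_unique he (e' := (i, k)) hk hc
    exact Finset.ne_of_mem_erase hi (by rw [this])
  rw [← this]
  linarith

end IsCTiling

/-! ### Counting at the vertices -/

/-- A tiling of `W` by congruent copies of a triangle with sides `s` and angles `θ`, where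
`θ 2 = 2π/3` and the other two angles are not rational multiples of `π`. -/
structure LabeledTiling {ι : Type*} (T : ι → CTri) (W : CTri) (s θ : Fin 3 → ℝ)
    (lab : ι → Fin 3 → Fin 3) : Prop where
  tiling : IsCTiling T W
  tile : ∀ i, IsTile (T i) s θ (lab i)
  gamma : θ 2 = 2 * Real.pi / 3
  sum : θ 0 + θ 1 = Real.pi / 3
  irr : ∀ q : ℚ, θ 1 ≠ q * Real.pi

section Defs

variable {ι : Type*} [Fintype ι] (T : ι → CTri) (lab : ι → Fin 3 → Fin 3)

/-- The number of tile corners with label `x` at the point `V`. -/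
def cnt (V : ℂ) (x : Fin 3) : ℕ := ((IsCTiling.cornersAt T V).filter fun c => lab c.1 c.2 = x).card

open scoped Classical in
/-- The pairs of edges which leave a common starting point in the same direction on opposite sides,
and of which exactly one has the label `y`. (The right edge ends at this point, as tile edges are
traversed counterclockwise.) -/
def mismatches (y : Fin 3) : Finset ((ι × Fin 3) × (ι × Fin 3)) :=
  {p | src T p.1 = tgt T p.2 ∧ edir T p.2 = -edir T p.1 ∧
    ¬(lab p.1.1 p.1.2 = y ↔ lab p.2.1 p.2.2 = y)}

open scoped Classical in
/-- The pairs of consecutive edges on one side of a line which meet in the relative interior of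
an edge on the other side, and of which exactly one has the label `y`. -/
def changes (y : Fin 3) : Finset ((ι × Fin 3) × (ι × Fin 3)) :=
  {p | tgt T p.1 = src T p.2 ∧ edir T p.2 = edir T p.1 ∧
    ¬(lab p.1.1 p.1.2 = y ↔ lab p.2.1 p.2.2 = y) ∧
    ∃ e, edir T e = -edir T p.1 ∧ On T e (tgt T p.1)}

end Defs

lemma CTri.sum_ang (W : CTri) : ∑ m, W.ang m = Real.pi := by
  have h0 : W.dir 1 = -(exp (W.ang 0 * I) * W.dir 2) := W.dir_succ 0
  have h1 : W.dir 2 = -(exp (W.ang 1 * I) * W.dir 0) := W.dir_succ 1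
  have h2 : W.dir 0 = -(exp (W.ang 2 * I) * W.dir 1) := W.dir_succ 2
  have h3 : Complex.exp ((∑ m, W.ang m : ℝ) * I) = -1 := by
    rw [Fin.sum_univ_three]
    push_cast
    rw [add_mul, add_mul, Complex.exp_add, Complex.exp_add]
    rw [h1, h2] at h0
    refine mul_right_cancel₀ (W.dir_ne_zero 1) ?_
    linear_combination h0
  rw [← Complex.exp_pi_mul_I, Complex.exp_eq_exp_iff_exists_int] at h3
  obtain ⟨n, hn⟩ := h3
  have hn : ∑ m, W.ang m = Real.pi + n * (2 * Real.pi) := by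
    have : ((∑ m, W.ang m : ℝ) : ℂ) = ((Real.pi + n * (2 * Real.pi) : ℝ) : ℂ) := by
      refine mul_right_cancel₀ I_ne_zero ?_
      rw [hn]
      push_cast
      ring
    exact_mod_cast this
  have hpi := Real.pi_pos
  have h4 := Fin.sum_univ_three W.ang
  have hlt : (n : ℝ) < 1 := by
    by_contra! hc
    nlinarith [(W.ang_mem 0).2, (W.ang_mem 1).2, (W.ang_mem 2).2]
  have hgt : (-1 : ℝ) < n := by
    by_contra! hc
    nlinarith [(W.ang_mem 0).1, (W.ang_mem 1).1, (W.ang_mem 2).1]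
  have hn0 : n = 0 := by
    have h5 : n < 1 := by exact_mod_cast hlt
    have h6 : -1 < n := by exact_mod_cast hgt
    omega
  rw [hn, hn0]
  simp

lemma not_on_of_src {ι : Type*} {T : ι → CTri} {e : ι × Fin 3} {V : ℂ} (h : src T e = V) : ¬ On T e V := by
  rintro h'
  rw [On, ← h] at h'
  exact (T e.1).not_onEdge_vertex _ _ h'

lemma not_on_of_tgt {ι : Type*} {T : ι → CTri} {e : ι × Fin 3} {V : ℂ} (h : tgt T e = V) : ¬ On T e V := by
  rintro h'
  rw [On, ← h] at h'
  exact (T e.1).not_onEdge_vertex _ _ h'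

namespace LabeledTiling

variable {ι : Type*} [Fintype ι] {T : ι → CTri} {W : CTri} {s θ : Fin 3 → ℝ}
  {lab : ι → Fin 3 → Fin 3}

/-- The angles `θ 1` and `π` are independent over the rationals. -/
lemma eq_of_angle_eq {β : ℝ} (hβ : ∀ q : ℚ, β ≠ q * Real.pi) {p q r k : ℕ}
    (h : p * (Real.pi / 3 - β) + q * β + r * (2 * Real.pi / 3) = k * Real.pi) :
    p = q ∧ q + 2 * r = 3 * k := by
  have hpq : p = q := by
    by_contra hne
    have hne : (q : ℝ) - p ≠ 0 := sub_ne_zero.mpr (by exact_mod_cast Ne.symm hne)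
    apply hβ ((k - p / 3 - 2 * r / 3) / (q - p))
    push_cast
    field_simp
    linear_combination 3 * h
  refine ⟨hpq, ?_⟩
  subst hpq
  have h2 : Real.pi * ((p : ℝ) + 2 * r - 3 * k) = 0 := by linear_combination 3 * h
  have h3 := (mul_eq_zero.mp h2).resolve_left Real.pi_ne_zero
  have h4 : (p : ℝ) + 2 * r = 3 * k := by linarith
  exact_mod_cast h4

lemma sum_ang_eq (h : LabeledTiling T W s θ lab) (V : ℂ) :
    ∑ c ∈ IsCTiling.cornersAt T V, (T c.1).ang c.2 =
      cnt T lab V 0 * θ 0 + cnt T lab V 1 * θ 1 + cnt T lab V 2 * θ 2 := by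
  rw [← Finset.sum_fiberwise_of_maps_to (t := Finset.univ) (g := fun c => lab c.1 c.2)
    fun _ _ => Finset.mem_univ _, Fin.sum_univ_three]
  have : ∀ x, ∑ c ∈ IsCTiling.cornersAt T V with lab c.1 c.2 = x, (T c.1).ang c.2 =
      cnt T lab V x * θ x := by
    intro x
    rw [Finset.sum_congr rfl (g := fun _ => θ x), Finset.sum_const, nsmul_eq_mul, cnt]
    intro c hc
    rw [(h.tile c.1).ang_eq, (Finset.mem_filter.mp hc).2]
  rw [this, this, this]

lemma counts_of_sum (h : LabeledTiling T W s θ lab) {V : ℂ} {k : ℕ}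
    (hs : ∑ c ∈ IsCTiling.cornersAt T V, (T c.1).ang c.2 = k * Real.pi) :
    cnt T lab V 0 = cnt T lab V 1 ∧ cnt T lab V 1 + 2 * cnt T lab V 2 = 3 * k := by
  refine eq_of_angle_eq h.irr ?_
  rw [← hs, h.sum_ang_eq, h.gamma, ← h.sum]
  ring

lemma card_cornersAt (V : ℂ) (T : ι → CTri) (lab : ι → Fin 3 → Fin 3) :
    (IsCTiling.cornersAt T V).card = cnt T lab V 0 + cnt T lab V 1 + cnt T lab V 2 := by
  rw [Finset.card_eq_sum_card_fiberwise (t := Finset.univ) (f := fun c => lab c.1 c.2)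
    fun _ _ => Finset.mem_univ _, Fin.sum_univ_three]
  rfl

open scoped Classical in
/-- Each corner at `V` with a label other than `y` is adjacent to exactly one edge with label
`y`. -/
lemma card_edges_at (h : LabeledTiling T W s θ lab) (V : ℂ) (y : Fin 3) :
    (Finset.univ.filter fun e : ι × Fin 3 => src T e = V ∧ lab e.1 e.2 = y).card +
      (Finset.univ.filter fun e : ι × Fin 3 => tgt T e = V ∧ lab e.1 e.2 = y).card =
    ((IsCTiling.cornersAt T V).filter fun c => lab c.1 c.2 ≠ y).card := by
  rw [IsCTiling.cornersAt, Finset.filter_filter]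
  simp only [Finset.card_filter]
  rw [← Finset.univ_product_univ, Finset.sum_product, Finset.sum_product, Finset.sum_product,
    ← Finset.sum_add_distrib]
  simp only [src, tgt]
  refine Finset.sum_congr rfl fun i _ => ?_
  have n1 : (-1 : Fin 3) = 2 := by decide
  have n2 : (-2 : Fin 3) = 1 := by decide
  rw [Fin.sum_univ_three, Fin.sum_univ_three, Fin.sum_univ_three]
  rcases (h.tile i).lab_eq with hl | hl <;> simp only [hl, n1, n2, neg_zero] <;> fin_cases y <;>
    simp [add_comm]

lemma card_filter_ne (V : ℂ) (y : Fin 3) (T : ι → CTri) (lab : ι → Fin 3 → Fin 3) :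
    ((IsCTiling.cornersAt T V).filter fun c => lab c.1 c.2 ≠ y).card + cnt T lab V y =
      cnt T lab V 0 + cnt T lab V 1 + cnt T lab V 2 := by
  rw [← card_cornersAt, cnt, add_comm, Finset.card_filter_add_card_filter_not]

/-- Edges which start at a point and edges which end at this point correspond to each other if
every edge continues on the other side of its line. -/
lemma card_eq_of_opposite (h : LabeledTiling T W s θ lab) {V : ℂ} {S E : Finset (ι × Fin 3)}
    (hS : ∀ e ∈ S, src T e = V) (hE : ∀ e ∈ E, tgt T e = V)
    (hSE : ∀ e ∈ S, ∃ e' ∈ E, edir T e' = -edir T e)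
    (hES : ∀ e ∈ E, ∃ e' ∈ S, edir T e' = -edir T e) : S.card = E.card := by
  apply le_antisymm
  · refine Finset.card_le_card_of_forall_subsingleton (fun e e' => edir T e' = -edir T e) hSE ?_
    intro e' he' e1 h1 e2 h2
    exact h.tiling.left_unique (neg_injective (h1.2.symm.trans h2.2)) (Or.inl (hS _ h1.1))
      (Or.inl (hS _ h2.1))
  · refine Finset.card_le_card_of_forall_subsingleton (fun e e' => edir T e' = -edir T e) hES ?_
    intro e' he' e1 h1 e2 h2
    exact h.tiling.right_unique (neg_injective (h1.2.symm.trans h2.2)) (Or.inl (hE _ h1.1))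
      (Or.inl (hE _ h2.1))

open scoped Classical in
/-- At an interior vertex which is surrounded by corners there are at most three angles `2π/3`. If
there are three, then three edges with label `y` meet in this vertex, so that not all of them
continue as such an edge on the other side of the line. -/
lemma vertex_full (h : LabeledTiling T W s θ lab) {V : ℂ} (hV : W.Inside V)
    (hne : (IsCTiling.cornersAt T V).Nonempty) (hno : ∀ e, ¬ On T e V) {y : Fin 3} (hy : y ≠ 2) :
    cnt T lab V 2 ≤ ((mismatches T lab y).filter fun p => src T p.1 = V).card + 2 := by
  have hs := h.tiling.sum_ang_cornersAt hne hno
  rw [W.theta_of_inside hV] at hs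
  have hc := h.counts_of_sum (V := V) (k := 2) (by exact_mod_cast hs)
  by_contra! hlt
  have h0 : ((mismatches T lab y).filter fun p => src T p.1 = V) = ∅ := by
    rw [← Finset.card_eq_zero]
    omega
  have hm : ∀ f g, src T f = V → tgt T g = V → edir T g = -edir T f →
      (lab f.1 f.2 = y ↔ lab g.1 g.2 = y) := by
    intro f g hf hg hd
    by_contra hl
    refine Finset.notMem_empty (f, g) (h0 ▸ ?_)
    simp only [mismatches, Finset.mem_filter, Finset.mem_univ, true_and]
    exact ⟨⟨hf.trans hg.symm, hd, hl⟩, hf⟩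
  have he := h.card_edges_at V y
  have hcard := h.card_eq_of_opposite (V := V)
    (S := Finset.univ.filter fun e : ι × Fin 3 => src T e = V ∧ lab e.1 e.2 = y)
    (E := Finset.univ.filter fun e : ι × Fin 3 => tgt T e = V ∧ lab e.1 e.2 = y) ?_ ?_ ?_ ?_
  · have hf := card_filter_ne V y T lab
    rw [hcard] at he
    fin_cases y <;> simp at hf hy he <;> omega
  · intro e he
    exact (Finset.mem_filter.mp he).2.1
  · intro e he
    exact (Finset.mem_filter.mp he).2.1
  · intro e he
    obtain ⟨h1, h2⟩ := (Finset.mem_filter.mp he).2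
    obtain ⟨e', hd, h3⟩ := h.tiling.exists_right_of_left hV (e := e) (Or.inl h1)
    have h3 := h3.resolve_right (hno e')
    exact ⟨e', Finset.mem_filter.mpr ⟨Finset.mem_univ _, h3, (hm e e' h1 h3 hd).mp h2⟩, hd⟩
  · intro e he
    obtain ⟨h1, h2⟩ := (Finset.mem_filter.mp he).2
    obtain ⟨e', hd, h3⟩ := h.tiling.exists_left_of_right hV (e := e) (Or.inl h1)
    have h3 := h3.resolve_right (hno e')
    exact ⟨e', Finset.mem_filter.mpr ⟨Finset.mem_univ _, h3,
      (hm e' e h3 h1 (by rw [hd, neg_neg])).mpr h2⟩, hd⟩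

open scoped Classical in
/-- At a vertex inside the edge `d` of a tile there is at most one angle `2π/3` and at most one change.
If there is one of each, then the number of edges with label `y` at the vertex is two, and exactly
one of them lies along `d`, so that the other one belongs to a mismatch. -/
lemma vertex_half (h : LabeledTiling T W s θ lab) {V : ℂ} {d : ι × Fin 3} (hd : On T d V)
    (hne : (IsCTiling.cornersAt T V).Nonempty) {y : Fin 3} (hy : y ≠ 2) :
    cnt T lab V 2 + ((changes T lab y).filter fun p => src T p.2 = V).card ≤
      ((mismatches T lab y).filter fun p => src T p.1 = V).card + 1 := by
  have hs := h.tiling.sum_ang_cornersAt_of_on hne hd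
  have hc := h.counts_of_sum (V := V) (k := 1) (by rw [hs]; simp)
  obtain ⟨c, hcV⟩ := hne
  have hcV : (T c.1).v c.2 = V := by simpa [IsCTiling.cornersAt] using hcV
  have hV := h.tiling.inside_of_on hd hcV
  have hC : ∀ f g, (f, g) ∈ ((changes T lab y).filter fun p => src T p.2 = V) →
      tgt T f = V ∧ src T g = V ∧ edir T f = -edir T d ∧ edir T g = -edir T d ∧
        ¬(lab f.1 f.2 = y ↔ lab g.1 g.2 = y) := by
    intro f g hfg
    simp only [changes, Finset.mem_filter, Finset.mem_univ, true_and] at hfg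
    obtain ⟨⟨h1, h2, h3, e, he, hon⟩, h4⟩ := hfg
    rw [h4] at h1
    rw [h1] at hon
    obtain rfl := h.tiling.on_unique hon hd hcV
    exact ⟨h1, h4, by rw [he, neg_neg], by rw [h2, he, neg_neg], h3⟩
  have hC1 : ((changes T lab y).filter fun p => src T p.2 = V).card ≤ 1 := by
    refine Finset.card_le_one.mpr ?_
    rintro ⟨f, g⟩ h1 ⟨f', g'⟩ h2
    obtain ⟨a1, a2, a3, a4, -⟩ := hC f g h1
    obtain ⟨b1, b2, b3, b4, -⟩ := hC f' g' h2
    exact Prod.ext (h.tiling.right_unique (a3.trans b3.symm) (Or.inl a1) (Or.inl b1))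
      (h.tiling.left_unique (a4.trans b4.symm) (Or.inl a2) (Or.inl b2))
  by_contra! hlt
  have h0 : ((mismatches T lab y).filter fun p => src T p.1 = V) = ∅ := by
    rw [← Finset.card_eq_zero]
    omega
  have hm : ∀ f g, src T f = V → tgt T g = V → edir T g = -edir T f →
      (lab f.1 f.2 = y ↔ lab g.1 g.2 = y) := by
    intro f g hf hg hd
    by_contra hl
    refine Finset.notMem_empty (f, g) (h0 ▸ ?_)
    simp only [mismatches, Finset.mem_filter, Finset.mem_univ, true_and]
    exact ⟨⟨hf.trans hg.symm, hd, hl⟩, hf⟩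
  obtain ⟨⟨f, g⟩, hfg⟩ := Finset.card_pos.mp (show 0 < _ by omega :
    0 < ((changes T lab y).filter fun p => src T p.2 = V).card)
  obtain ⟨hf, hg, hdf, hdg, hl⟩ := hC f g hfg
  have he := h.card_edges_at V y
  have hcard := h.card_eq_of_opposite (V := V)
    -- The edges `g` and `f` lie along `d`; all other edges have opposite edges at `V`.
    (S := (Finset.univ.filter fun e : ι × Fin 3 => src T e = V ∧ lab e.1 e.2 = y).erase g)
    (E := (Finset.univ.filter fun e : ι × Fin 3 => tgt T e = V ∧ lab e.1 e.2 = y).erase f)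
    ?_ ?_ ?_ ?_
  · have hf2 := card_filter_ne V y T lab
    by_cases hfy : lab f.1 f.2 = y
    · have hgy : ¬ lab g.1 g.2 = y := fun h => hl (by simp [hfy, h])
      rw [Finset.erase_eq_of_notMem (by simp [hgy])] at hcard
      have := Finset.card_erase_add_one (a := f)
        (s := Finset.univ.filter fun e : ι × Fin 3 => tgt T e = V ∧ lab e.1 e.2 = y)
        (by simp [hf, hfy])
      fin_cases y <;> simp at hf2 hy he hcard this <;> omega
    · have hgy : lab g.1 g.2 = y := by tauto
      rw [Finset.erase_eq_of_notMem (a := f) (by simp [hfy])] at hcard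
      have := Finset.card_erase_add_one (a := g)
        (s := Finset.univ.filter fun e : ι × Fin 3 => src T e = V ∧ lab e.1 e.2 = y)
        (by simp [hg, hgy])
      fin_cases y <;> simp at hf2 hy he hcard this <;> omega
  · intro e he
    exact (Finset.mem_filter.mp (Finset.mem_of_mem_erase he)).2.1
  · intro e he
    exact (Finset.mem_filter.mp (Finset.mem_of_mem_erase he)).2.1
  · intro e he
    obtain ⟨h1, h2⟩ := (Finset.mem_filter.mp (Finset.mem_of_mem_erase he)).2
    obtain ⟨e', hd', h3⟩ := h.tiling.exists_right_of_left hV (e := e) (Or.inl h1)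
    have h3 : tgt T e' = V := by
      refine h3.resolve_right fun hon => Finset.ne_of_mem_erase he ?_
      obtain rfl := h.tiling.on_unique hon hd hcV
      exact h.tiling.left_unique (by rw [hdg, hd', neg_neg]) (Or.inl h1) (Or.inl hg)
    refine ⟨e', Finset.mem_erase.mpr ⟨?_, Finset.mem_filter.mpr
      ⟨Finset.mem_univ _, h3, (hm e e' h1 h3 hd').mp h2⟩⟩, hd'⟩
    rintro rfl
    have := h.tiling.left_unique (neg_injective (hd'.symm.trans hdf)) (Or.inl h1) (Or.inr hd)
    exact not_on_of_src h1 (this ▸ hd)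
  · intro e he
    obtain ⟨h1, h2⟩ := (Finset.mem_filter.mp (Finset.mem_of_mem_erase he)).2
    obtain ⟨e', hd', h3⟩ := h.tiling.exists_left_of_right hV (e := e) (Or.inl h1)
    have h3 : src T e' = V := by
      refine h3.resolve_right fun hon => Finset.ne_of_mem_erase he ?_
      obtain rfl := h.tiling.on_unique hon hd hcV
      exact h.tiling.right_unique (by rw [hdf, hd', neg_neg]) (Or.inl h1) (Or.inl hf)
    refine ⟨e', Finset.mem_erase.mpr ⟨?_, Finset.mem_filter.mpr
      ⟨Finset.mem_univ _, h3, (hm e' e h3 h1 (by rw [hd', neg_neg])).mpr h2⟩⟩, hd'⟩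
    rintro rfl
    have := h.tiling.right_unique (neg_injective (hd'.symm.trans hdg)) (Or.inl h1) (Or.inr hd)
    exact not_on_of_tgt h1 (this ▸ hd)

open scoped Classical in
lemma changes_eq_empty {V : ℂ} (hno : ∀ e, ¬ On T e V) (y : Fin 3) :
    ((changes T lab y).filter fun p => src T p.2 = V) = ∅ := by
  ext p
  simp only [changes, Finset.mem_filter, Finset.mem_univ, true_and, Finset.notMem_empty, iff_false]
  rintro ⟨⟨h1, -, -, e, -, he⟩, rfl⟩
  exact hno e (h1 ▸ he)

/-- Every corner of the tiled triangle is a corner of some tile. -/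
lemma cornersAt_nonempty (h : LabeledTiling T W s θ lab) (m : Fin 3) :
    (IsCTiling.cornersAt T (W.v m)).Nonempty := by
  obtain ⟨i, hi⟩ := (h.tiling.cover _).mpr (W.closed_vertex m)
  have hs := h.tiling.sum_theta_le (W.v m) {i}
  rw [Finset.sum_singleton, W.theta_vertex] at hs
  rcases (T i).closed_cases hi with ⟨k, hk⟩ | ⟨k, hk⟩ | hi
  · exact ⟨(i, k), by simpa [IsCTiling.cornersAt] using hk⟩
  · rw [(T i).theta_of_onEdge hk] at hs
    linarith [(W.ang_mem m).2]
  · rw [(T i).theta_of_inside hi] at hs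
    linarith [(W.ang_mem m).2, Real.pi_pos]

lemma not_on_of_not_inside (h : LabeledTiling T W s θ lab) {V : ℂ}
    (hne : (IsCTiling.cornersAt T V).Nonempty) (hV : ¬ W.Inside V) (e : ι × Fin 3) :
    ¬ On T e V := by
  obtain ⟨c, hcV⟩ := hne
  exact fun he => hV (h.tiling.inside_of_on he (by simpa [IsCTiling.cornersAt] using hcV))

/-- The angles of a corner of the tiled triangle. -/
lemma sum_ang_corner (h : LabeledTiling T W s θ lab) (m : Fin 3) :
    ∑ c ∈ IsCTiling.cornersAt T (W.v m), (T c.1).ang c.2 = W.ang m := by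
  rw [h.tiling.sum_ang_cornersAt (h.cornersAt_nonempty m)
    (h.not_on_of_not_inside (h.cornersAt_nonempty m) (W.not_inside_vertex m)), W.theta_vertex]

open scoped Classical in
/-- The number of angles `2π/3` at a vertex is at most the number of mismatches, minus the number of
changes, plus the total angle divided by `π`. At the corners of the tiled triangle, which are assumed
to contain no angle `2π/3`, there is a surplus. -/
lemma vertex_inequality (h : LabeledTiling T W s θ lab) (h2 : ∀ m, cnt T lab (W.v m) 2 = 0)
    {V : ℂ} (hne : (IsCTiling.cornersAt T V).Nonempty) {y : Fin 3} (hy : y ≠ 2) :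
    (cnt T lab V 2 + (((changes T lab y).filter fun p => src T p.2 = V).card : ℝ)) * Real.pi +
      ∑ m, (if W.v m = V then W.ang m else 0) ≤
    ((mismatches T lab y).filter fun p => src T p.1 = V).card * Real.pi +
      ∑ c ∈ IsCTiling.cornersAt T V, (T c.1).ang c.2 := by
  have hpi := Real.pi_pos
  have hW : W.Closed V := by
    obtain ⟨c, hc⟩ := hne
    have hc : (T c.1).v c.2 = V := by simpa [IsCTiling.cornersAt] using hc
    exact hc ▸ h.tiling.closed_of_vertex c
  rcases W.closed_cases hW with ⟨m, rfl⟩ | hb | hi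
  · rw [h2, h.sum_ang_corner, changes_eq_empty
      (h.not_on_of_not_inside (h.cornersAt_nonempty m) (W.not_inside_vertex m)),
      Finset.sum_eq_single_of_mem m (Finset.mem_univ _)]
    · simp only [if_true, Finset.card_empty, Nat.cast_zero, add_zero, zero_mul, zero_add]
      linarith [mul_nonneg (Nat.cast_nonneg (α := ℝ)
        ((mismatches T lab y).filter fun p => src T p.1 = W.v m).card) hpi.le]
    · intro k _ hk
      rw [if_neg fun h => hk (W.v_injective h)]
  · obtain ⟨k, hk⟩ := hb
    have hno := h.not_on_of_not_inside hne (V := V) (by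
      intro hi
      have := W.theta_of_inside hi
      rw [W.theta_of_onEdge hk] at this
      linarith)
    have hs := h.tiling.sum_ang_cornersAt hne hno
    rw [W.theta_of_onEdge hk] at hs
    have hc := h.counts_of_sum (V := V) (k := 1) (by rw [hs]; simp)
    have hc2 : (cnt T lab V 2 : ℝ) ≤ 1 := by exact_mod_cast (show cnt T lab V 2 ≤ 1 by omega)
    rw [hs, changes_eq_empty hno, Finset.sum_eq_zero]
    · simp only [Finset.card_empty, Nat.cast_zero, add_zero]
      linarith [mul_nonneg (Nat.cast_nonneg (α := ℝ)
        ((mismatches T lab y).filter fun p => src T p.1 = V).card) hpi.le,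
        mul_le_mul_of_nonneg_right hc2 hpi.le]
    · intro m _
      rw [if_neg]
      rintro rfl
      exact W.not_onEdge_vertex _ _ hk
  · have h0 : ∑ m, (if W.v m = V then W.ang m else 0) = 0 := by
      refine Finset.sum_eq_zero fun m _ => if_neg ?_
      rintro rfl
      exact W.not_inside_vertex m hi
    rw [h0, add_zero]
    by_cases hon : ∃ e, On T e V
    · obtain ⟨e, he⟩ := hon
      rw [h.tiling.sum_ang_cornersAt_of_on hne he, ← add_one_mul]
      exact mul_le_mul_of_nonneg_right (by exact_mod_cast h.vertex_half he hne hy) hpi.le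
    · push Not at hon
      rw [h.tiling.sum_ang_cornersAt hne hon, W.theta_of_inside hi, changes_eq_empty hon,
        ← add_mul]
      refine mul_le_mul_of_nonneg_right ?_ hpi.le
      simpa using (by exact_mod_cast h.vertex_full hi hne hon hy :
        (cnt T lab V 2 : ℝ) ≤ (((mismatches T lab y).filter fun p => src T p.1 = V).card : ℝ) + 2)

open scoped Classical in
/-- Summation over all vertices of the tiling: there are more mismatches than changes. -/
theorem card_changes_lt (h : LabeledTiling T W s θ lab) (h2 : ∀ m, cnt T lab (W.v m) 2 = 0)
    {y : Fin 3} (hy : y ≠ 2) : (changes T lab y).card < (mismatches T lab y).card := by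
  set VV : Finset ℂ := Finset.univ.image fun c : ι × Fin 3 => (T c.1).v c.2 with hVV
  have hmem : ∀ c : ι × Fin 3, (T c.1).v c.2 ∈ VV :=
    fun c => Finset.mem_image_of_mem _ (Finset.mem_univ c)
  have hsum := Finset.sum_le_sum (s := VV) fun V hV => by
    obtain ⟨c, -, hc⟩ := Finset.mem_image.mp hV
    exact h.vertex_inequality h2 (V := V) ⟨c, by simpa [IsCTiling.cornersAt] using hc⟩ hy
  have e1 : ∑ V ∈ VV, (((changes T lab y).filter fun p => src T p.2 = V).card : ℝ) =
      (changes T lab y).card := by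
    exact_mod_cast (Finset.card_eq_sum_card_fiberwise (f := fun p : (ι × Fin 3) × (ι × Fin 3) => src T p.2)
      fun p _ => hmem (p.2.1, p.2.2 + 1)).symm
  have e2 : ∑ V ∈ VV, (((mismatches T lab y).filter fun p => src T p.1 = V).card : ℝ) =
      (mismatches T lab y).card := by
    exact_mod_cast (Finset.card_eq_sum_card_fiberwise (f := fun p : (ι × Fin 3) × (ι × Fin 3) => src T p.1)
      fun p _ => hmem (p.1.1, p.1.2 + 1)).symm
  have e3 : ∑ V ∈ VV, ∑ m, (if W.v m = V then W.ang m else 0) = Real.pi := by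
    rw [Finset.sum_comm, ← W.sum_ang]
    refine Finset.sum_congr rfl fun m _ => ?_
    obtain ⟨c, hc⟩ := h.cornersAt_nonempty m
    have hc : (T c.1).v c.2 = W.v m := by simpa [IsCTiling.cornersAt] using hc
    rw [Finset.sum_ite_eq, if_pos (hc ▸ hmem c)]
  have e4 : ∑ V ∈ VV, ∑ c ∈ IsCTiling.cornersAt T V, (T c.1).ang c.2 =
      Fintype.card ι * Real.pi := by
    have := Finset.sum_fiberwise_of_maps_to (s := Finset.univ) (t := VV)
      (g := fun c : ι × Fin 3 => (T c.1).v c.2) (fun c _ => hmem c)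
      (fun c : ι × Fin 3 => (T c.1).ang c.2)
    simp only [IsCTiling.cornersAt]
    rw [this, ← Finset.univ_product_univ, Finset.sum_product]
    simp [CTri.sum_ang]
  have e5 : ∑ V ∈ VV, (cnt T lab V 2 : ℝ) = Fintype.card ι := by
    have e6 : ∀ V ∈ VV, cnt T lab V 2 =
        (Finset.univ.filter fun c : ι × Fin 3 => (T c.1).v c.2 = V ∧ lab c.1 c.2 = 2).card := by
      intro V _
      rw [cnt, IsCTiling.cornersAt, Finset.filter_filter]
    have e7 := Finset.card_eq_sum_card_fiberwise (f := fun c : ι × Fin 3 => (T c.1).v c.2)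
      (s := Finset.univ.filter fun c : ι × Fin 3 => lab c.1 c.2 = 2) (t := VV) fun c _ => hmem c
    simp only [Finset.filter_filter] at e7
    have e8 : (Finset.univ.filter fun c : ι × Fin 3 => lab c.1 c.2 = 2).card =
        Fintype.card ι := by
      rw [Finset.card_filter, ← Finset.univ_product_univ, Finset.sum_product,
        Fintype.card_eq_sum_ones]
      refine Finset.sum_congr rfl fun i _ => ?_
      rw [Fin.sum_univ_three]
      have n1 : (-1 : Fin 3) = 2 := by decide
      have n2 : (-2 : Fin 3) = 1 := by decide
      rcases (h.tile i).lab_eq with hl | hl <;> simp [hl, n1, n2]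
    rw [← e8, e7]
    push_cast
    refine Finset.sum_congr rfl fun V hV => ?_
    rw [e6 V hV]
    simp only [and_comm]
  simp only [add_mul, Finset.sum_add_distrib, ← Finset.sum_mul, e1, e2, e3, e4, e5] at hsum
  have : ((changes T lab y).card : ℝ) + 1 ≤ (mismatches T lab y).card := by
    refine le_of_mul_le_mul_right ?_ Real.pi_pos
    linarith
  exact_mod_cast this

end LabeledTiling

/-! ### Walking along segments -/

section Walk

variable {ι : Type*} (T : ι → CTri) (lab : ι → Fin 3 → Fin 3) (y : Fin 3)

/-- One step of a walk along the two sides of a line: `p.1` and `p.2` are opposite edges, and the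
one which ends first is replaced by its continuation, provided that this continuation has the
label `y` if and only if the replaced edge has it. -/
def Step (p q : (ι × Fin 3) × (ι × Fin 3)) : Prop :=
  (q.2 = p.2 ∧ tgt T p.1 = src T q.1 ∧ edir T q.1 = edir T p.1 ∧ On T p.2 (tgt T p.1) ∧
    (lab q.1.1 q.1.2 = y ↔ lab p.1.1 p.1.2 = y)) ∨
  (q.1 = p.1 ∧ tgt T q.2 = src T p.2 ∧ edir T q.2 = edir T p.2 ∧ On T p.1 (src T p.2) ∧
    (lab q.2.1 q.2.2 = y ↔ lab p.2.1 p.2.2 = y))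

/-- The walk stops at `p` since the edge which ends first is followed by an edge of the other kind;
`c` is the pair of these two edges. -/
def StopsAt (p c : (ι × Fin 3) × (ι × Fin 3)) : Prop :=
  (c.1 = p.1 ∧ On T p.2 (tgt T p.1)) ∨ (c.2 = p.2 ∧ On T p.1 (src T p.2))

/-- The sums of side lengths among which only the side `y` (if `P` holds), respectively only the
other two sides (if `P` does not hold) are used. -/
def sideSums (s : Fin 3 → ℝ) (y : Fin 3) (P : Prop) : AddSubmonoid ℝ :=
  AddSubmonoid.closure (s '' {x | x = y ↔ P})

/-- The pairs of opposite edges which overlap in more than a point and of which exactly one has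
the label `y`; the starting point of the first and the end point of the second have distances
from `V` that are sums of side lengths of the respective kind. -/
structure WalkState (s : Fin 3 → ℝ) (V u : ℂ) (p : (ι × Fin 3) × (ι × Fin 3)) : Prop where
  fst_dir : edir T p.1 = u
  snd_dir : edir T p.2 = -u
  diff : ¬(lab p.1.1 p.1.2 = y ↔ lab p.2.1 p.2.2 = y)
  dist : ∃ A ∈ sideSums s y (lab p.1.1 p.1.2 = y), ∃ B ∈ sideSums s y (lab p.2.1 p.2.2 = y),
    src T p.1 = V + (A : ℂ) * u ∧ tgt T p.2 = V + (B : ℂ) * u ∧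
    A < B + (T p.2.1).len p.2.2 ∧ B < A + (T p.1.1).len p.1.2

end Walk

variable {ι : Type*} {T : ι → CTri} {W : CTri} {s θ : Fin 3 → ℝ}
  {lab : ι → Fin 3 → Fin 3} {y : Fin 3}

lemma tgt_eq_src_add (T : ι → CTri) (e : ι × Fin 3) :
    tgt T e = src T e + ((T e.1).len e.2 : ℂ) * edir T e := (T e.1).tgt_eq e.2

lemma On.coord_lt {e : ι × Fin 3} {V : ℂ} (h : On T e V) :
    coord (src T e) (edir T e) < coord V (edir T e) ∧
      coord V (edir T e) < coord (tgt T e) (edir T e) := by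
  obtain ⟨t, h0, h1, rfl⟩ := h
  have hn : ‖edir T e‖ = 1 := (T e.1).norm_dir e.2
  have h2 : coord (src T e + (t : ℂ) * edir T e) (edir T e) = coord (src T e) (edir T e) + t :=
    coord_add_smul _ _ _ hn
  have h3 := (T e.1).coord_tgt e.2
  simp only [src, edir, tgt] at *
  rw [h2, h3]
  constructor <;> linarith

lemma ne_of_edir {e e' : ι × Fin 3} (h : edir T e = -edir T e') : e ≠ e' := by
  rintro rfl
  exact (T e.1).dir_ne_zero e.2 (self_eq_neg.mp h)

lemma src_eq_vertex (T : ι → CTri) (e : ι × Fin 3) :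
    (T (e.1, e.2 + 1).1).v (e.1, e.2 + 1).2 = src T e :=
  rfl

lemma tgt_eq_vertex (T : ι → CTri) (e : ι × Fin 3) :
    (T (e.1, e.2 + 2).1).v (e.1, e.2 + 2).2 = tgt T e :=
  rfl

/-- Mismatches have no predecessor. -/
lemma not_step_of_src_eq_tgt {p q : (ι × Fin 3) × (ι × Fin 3)} (hq : src T q.1 = tgt T q.2) :
    ¬ Step T lab y p q := by
  rintro (⟨a1, a2, a3, a4, -⟩ | ⟨a1, a2, a3, a4, -⟩)
  · rw [a2, hq, ← a1] at a4
    exact not_on_of_tgt rfl a4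
  · rw [← a2, ← hq, ← a1] at a4
    exact not_on_of_src rfl a4

/-- Walks proceed in the direction `u`, hence they terminate. -/
lemma coord_lt_of_step {V u : ℂ} {p q : (ι × Fin 3) × (ι × Fin 3)} (h : Step T lab y p q)
    (hp : WalkState T lab y s V u p) :
    coord (src T p.1) u + coord (tgt T p.2) u < coord (src T q.1) u + coord (tgt T q.2) u := by
  have h1 : coord (tgt T p.1) (edir T p.1) = coord (src T p.1) (edir T p.1) + _ :=
    (T p.1.1).coord_tgt p.1.2
  have h2 : coord (tgt T p.2) (edir T p.2) = coord (src T p.2) (edir T p.2) + _ :=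
    (T p.2.1).coord_tgt p.2.2
  rw [hp.fst_dir] at h1
  rw [hp.snd_dir, coord_neg, coord_neg] at h2
  have pf := (T p.1.1).len_pos p.1.2
  have pg := (T p.2.1).len_pos p.2.2
  rcases h with ⟨a1, a2, -⟩ | ⟨a1, a2, -⟩
  · rw [a1, ← a2]; linarith
  · rw [a1, a2]; linarith

lemma LabeledTiling.len_mem_sideSums (h : LabeledTiling T W s θ lab) (e : ι × Fin 3) :
    (T e.1).len e.2 ∈ sideSums s y (lab e.1 e.2 = y) := by
  rw [(h.tile e.1).len_eq]
  exact AddSubmonoid.subset_closure ⟨_, Iff.rfl, rfl⟩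

lemma LabeledTiling.side_pos (h : LabeledTiling T W s θ lab) (i : ι) (x : Fin 3) : 0 < s x := by
  rcases (h.tile i).lab_eq with hl | hl
  · rw [← hl x, ← (h.tile i).len_eq]
    exact (T i).len_pos x
  · rw [← neg_neg x, ← hl (-x), ← (h.tile i).len_eq]
    exact (T i).len_pos (-x)

lemma sideSums_nonneg (hs : ∀ x, 0 < s x) {P : Prop} {a : ℝ} (ha : a ∈ sideSums s y P) :
    0 ≤ a := by
  have : sideSums s y P ≤ AddSubmonoid.nonneg ℝ := by
    refine AddSubmonoid.closure_le.mpr ?_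
    rintro _ ⟨x, -, rfl⟩
    exact (hs x).le
  exact this ha

variable [Fintype ι]

/-- Walks are determined by their last state. -/
lemma Step.left_unique (h : IsCTiling T W) {p p' q : (ι × Fin 3) × (ι × Fin 3)}
    (hq : edir T q.2 = -edir T q.1) (h1 : Step T lab y p q) (h2 : Step T lab y p' q) : p = p' := by
  have key : On T q.2 (src T q.1) → On T q.1 (tgt T q.2) → False := by
    intro a b
    have a := a.coord_lt.2
    have b := b.coord_lt.1
    rw [hq, coord_neg, coord_neg] at a
    linarith
  obtain ⟨f, g⟩ := p
  obtain ⟨f', g'⟩ := p'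
  rcases h1 with ⟨a1, a2, a3, a4, -⟩ | ⟨a1, a2, a3, a4, -⟩ <;>
    rcases h2 with ⟨b1, b2, b3, b4, -⟩ | ⟨b1, b2, b3, b4, -⟩
  · exact Prod.ext (h.right_unique (a3.symm.trans b3) (Or.inl a2) (Or.inl b2)) (a1.symm.trans b1)
  · exact (key (by rw [a1, ← a2]; exact a4) (by rw [b1, b2]; exact b4)).elim
  · exact (key (by rw [b1, ← b2]; exact b4) (by rw [a1, a2]; exact a4)).elim
  · exact Prod.ext (a1.symm.trans b1)
      (h.left_unique (a3.symm.trans b3) (Or.inl a2.symm) (Or.inl b2.symm))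

/-- The last state of a walk is determined by the change at which it stops: otherwise the two kinds
of labels would distinguish three edges. -/
lemma StopsAt.unique (h : IsCTiling T W) {p p' c : (ι × Fin 3) × (ι × Fin 3)}
    (hc : c ∈ changes T lab y)
    (hp : ¬(lab p.1.1 p.1.2 = y ↔ lab p.2.1 p.2.2 = y))
    (hp' : ¬(lab p'.1.1 p'.1.2 = y ↔ lab p'.2.1 p'.2.2 = y))
    (h1 : StopsAt T p c) (h2 : StopsAt T p' c) : p = p' := by
  classical
  simp only [changes, Finset.mem_filter, Finset.mem_univ, true_and] at hc
  obtain ⟨c1, c2, c3, -⟩ := hc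
  obtain ⟨f, g⟩ := p
  obtain ⟨f', g'⟩ := p'
  obtain ⟨x, z⟩ := c
  simp only at *
  rcases h1 with ⟨a1, a2⟩ | ⟨a1, a2⟩ <;> rcases h2 with ⟨b1, b2⟩ | ⟨b1, b2⟩ <;>
    simp only at a1 b1 a2 b2 <;> subst a1 <;> subst b1
  · rw [h.on_unique a2 b2 (tgt_eq_vertex T _)]
  · rw [← c1] at b2
    obtain rfl := h.on_unique a2 b2 (tgt_eq_vertex T _)
    exact (by tauto : False).elim
  · rw [c1] at b2
    obtain rfl := h.on_unique a2 b2 (src_eq_vertex T _)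
    exact (by tauto : False).elim
  · rw [h.on_unique a2 b2 (src_eq_vertex T _)]

namespace LabeledTiling

/-- A walk can only stop at a change, since the two sides cannot end simultaneously. -/
lemma step_or_stopsAt (h : LabeledTiling T W s θ lab)
    (hrel : ∀ a ∈ sideSums s y True, 0 < a → a ∉ sideSums s y False) {V u : ℂ}
    {p : (ι × Fin 3) × (ι × Fin 3)} (hp : WalkState T lab y s V u p) :
    (∃ q, Step T lab y p q ∧ WalkState T lab y s V u q) ∨
      ∃ c ∈ changes T lab y, StopsAt T p c := by
  classical
  obtain ⟨f, g⟩ := p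
  obtain ⟨hf, hg, hd, A, hA, B, hB, hsf, htg, hAB, hBA⟩ := hp
  simp only at *
  have htf : tgt T f = V + ((A + (T f.1).len f.2 : ℝ) : ℂ) * u := by
    rw [tgt_eq_src_add, hsf, hf]; push_cast; ring
  have hsg : src T g = V + ((B + (T g.1).len g.2 : ℝ) : ℂ) * u := by
    have := tgt_eq_src_add T g
    rw [htg, hg] at this
    push_cast
    linear_combination -this
  have hA' := add_mem hA (h.len_mem_sideSums (y := y) f)
  have hB' := add_mem hB (h.len_mem_sideSums (y := y) g)
  have pf := (T f.1).len_pos f.2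
  have pg := (T g.1).len_pos g.2
  rcases lt_trichotomy (A + (T f.1).len f.2) (B + (T g.1).len g.2) with hlt | heq | hgt
  · have hon : On T g (tgt T f) := by
      refine ⟨B + (T g.1).len g.2 - (A + (T f.1).len f.2), by linarith, by linarith, ?_⟩
      change tgt T f = src T g + _ * edir T g
      rw [hsg, htf, hg]
      push_cast
      ring
    obtain ⟨f', hd', hf'⟩ := h.tiling.exists_left_of_right
      (h.tiling.inside_of_on hon (tgt_eq_vertex T f)) (Or.inr hon)
    have hf'' : src T f' = tgt T f := by
      refine hf'.resolve_right fun ho => ne_of_edir hd' ?_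
      exact h.tiling.on_unique ho hon (tgt_eq_vertex T f)
    rw [hg, neg_neg] at hd'
    by_cases hl : lab f'.1 f'.2 = y ↔ lab f.1 f.2 = y
    · refine Or.inl ⟨(f', g), Or.inl ⟨rfl, hf''.symm, hd'.trans hf.symm, hon, hl⟩, hd', hg, ?_,
        A + (T f.1).len f.2, ?_, B, hB, hf''.trans htf, htg, hlt, ?_⟩
      · simp only; tauto
      · simp only; rwa [propext hl]
      · have := (T f'.1).len_pos f'.2
        simp only; linarith
    · refine Or.inr ⟨(f, f'), ?_, Or.inl ⟨rfl, hon⟩⟩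
      simp only [changes, Finset.mem_filter, Finset.mem_univ, true_and]
      exact ⟨hf''.symm, hd'.trans hf.symm, by tauto, g, by rw [hg, hf], hon⟩
  -- If both edges end at the same point, the sums of the lengths on both sides agree.
  · exfalso
    have nA := sideSums_nonneg (h.side_pos f.1) hA
    have nB := sideSums_nonneg (h.side_pos f.1) hB
    by_cases hy : lab f.1 f.2 = y
    · have hy' : ¬ lab g.1 g.2 = y := by tauto
      simp only [hy, hy'] at hA' hB'
      exact hrel _ hA' (by linarith) (heq ▸ hB')
    · have hy' : lab g.1 g.2 = y := by tauto
      simp only [hy, hy'] at hA' hB'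
      exact hrel _ hB' (by linarith) (heq ▸ hA')
  · have hon : On T f (src T g) := by
      refine ⟨B + (T g.1).len g.2 - A, by linarith, by linarith, ?_⟩
      change src T g = src T f + _ * edir T f
      rw [hsg, hsf, hf]
      push_cast
      ring
    obtain ⟨g', hd', hg'⟩ := h.tiling.exists_right_of_left
      (h.tiling.inside_of_on hon (src_eq_vertex T g)) (Or.inr hon)
    have hg'' : tgt T g' = src T g := by
      refine hg'.resolve_right fun ho => ne_of_edir hd' ?_
      exact h.tiling.on_unique ho hon (src_eq_vertex T g)
    rw [hf] at hd'
    by_cases hl : lab g'.1 g'.2 = y ↔ lab g.1 g.2 = y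
    · refine Or.inl ⟨(f, g'), Or.inr ⟨rfl, hg'', hd'.trans hg.symm, hon, hl⟩, hf, hd', ?_,
        A, hA, B + (T g.1).len g.2, ?_, hsf, hg''.trans hsg, ?_, hgt⟩
      · simp only; tauto
      · simp only; rwa [propext hl]
      · have := (T g'.1).len_pos g'.2
        simp only; linarith
    · refine Or.inr ⟨(g', g), ?_, Or.inr ⟨rfl, hon⟩⟩
      simp only [changes, Finset.mem_filter, Finset.mem_univ, true_and]
      exact ⟨hg'', hg.trans hd'.symm, hl, f, by rw [hd', hf, neg_neg], hg''.symm ▸ hon⟩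

lemma walkState_of_mem_mismatches {p : (ι × Fin 3) × (ι × Fin 3)} (hp : p ∈ mismatches T lab y) :
    WalkState T lab y s (src T p.1) (edir T p.1) p := by
  classical
  simp only [mismatches, Finset.mem_filter, Finset.mem_univ, true_and] at hp
  refine ⟨rfl, hp.2.1, hp.2.2, 0, zero_mem _, 0, zero_mem _, by simp, by simp [hp.1], ?_, ?_⟩ <;>
    rw [zero_add] <;> exact CTri.len_pos _ _

/-- Every walk which starts at a mismatch ends at a change. -/
lemma exists_stopsAt (h : LabeledTiling T W s θ lab)
    (hrel : ∀ a ∈ sideSums s y True, 0 < a → a ∉ sideSums s y False)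
    {p : (ι × Fin 3) × (ι × Fin 3)} (hp : p ∈ mismatches T lab y) :
    ∃ c ∈ changes T lab y, ∃ q,
      Relation.ReflTransGen (fun p q => Step T lab y p q ∧ edir T q.2 = -edir T q.1) p q ∧
      ¬(lab q.1.1 q.1.2 = y ↔ lab q.2.1 q.2.2 = y) ∧ StopsAt T q c := by
  classical
  set V := src T p.1
  set u := edir T p.1
  obtain ⟨q, hq, hmax⟩ := Finset.exists_max_image
    (Finset.univ.filter fun q => Relation.ReflTransGen
      (fun p q => Step T lab y p q ∧ edir T q.2 = -edir T q.1) p q ∧ WalkState T lab y s V u q)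
    (fun q => coord (src T q.1) u + coord (tgt T q.2) u)
    ⟨p, Finset.mem_filter.mpr ⟨Finset.mem_univ _, .refl, walkState_of_mem_mismatches hp⟩⟩
  obtain ⟨-, hpq, hst⟩ := Finset.mem_filter.mp hq
  rcases h.step_or_stopsAt hrel hst with ⟨q', h1, h2⟩ | ⟨c, hc, h1⟩
  · have := hmax q' (Finset.mem_filter.mpr ⟨Finset.mem_univ _,
      hpq.tail ⟨h1, by rw [h2.snd_dir, h2.fst_dir]⟩, h2⟩)
    exact absurd (coord_lt_of_step h1 hst) this.not_gt
  · exact ⟨c, hc, q, hpq, hst.diff, h1⟩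

/-- If no positive multiple of the side `y` is a sum of the other sides, then there are at most as
many mismatches as changes. -/
theorem card_mismatches_le (h : LabeledTiling T W s θ lab)
    (hrel : ∀ a ∈ sideSums s y True, 0 < a → a ∉ sideSums s y False) :
    (mismatches T lab y).card ≤ (changes T lab y).card := by
  classical
  refine Finset.card_le_card_of_forall_subsingleton _ (fun p hp => h.exists_stopsAt hrel hp) ?_
  rintro c hc p ⟨hp, q, hpq, hq, hs⟩ p' ⟨hp', q', hpq', hq', hs'⟩
  obtain rfl := StopsAt.unique h.tiling hc hq hq' hs hs'
  simp only [mismatches, Finset.mem_filter, Finset.mem_univ, true_and] at hp hp'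
  rw [← Relation.reflTransGen_swap] at hpq hpq'
  rcases Relation.ReflTransGen.total_of_right_unique
    (fun _ _ _ h1 h2 => h1.1.left_unique h.tiling h1.2 h2.1) hpq hpq' with h1 | h1
  · rcases h1.cases_head with h2 | ⟨_, h2, -⟩
    · exact h2
    · exact absurd h2.1 (not_step_of_src_eq_tgt hp.1)
  · rcases h1.cases_head with h2 | ⟨_, h2, -⟩
    · exact h2.symm
    · exact absurd h2.1 (not_step_of_src_eq_tgt hp'.1)

/-- A positive multiple of the side `y` is a sum of the other sides. -/
theorem exists_relation (h : LabeledTiling T W s θ lab) (h2 : ∀ m, cnt T lab (W.v m) 2 = 0)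
    (hy : y ≠ 2) : ∃ a ∈ sideSums s y True, 0 < a ∧ a ∈ sideSums s y False := by
  by_contra! hrel
  exact (h.card_changes_lt h2 hy).not_ge (h.card_mismatches_le hrel)

end LabeledTiling

/-! ### Commensurability of the sides -/

lemma sin_arg_div {x y : ℂ} (hx : x ≠ 0) (hy : y ≠ 0) :
    ‖x‖ * ‖y‖ * Real.sin (arg (y / x)) = cross x y := by
  have hx' : ‖x‖ ≠ 0 := norm_ne_zero_iff.mpr hx
  have hy' : ‖y‖ ≠ 0 := norm_ne_zero_iff.mpr hy
  rw [sin_arg, norm_div, div_im, cross, normSq_eq_norm_sq]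
  field_simp

namespace CTri

lemma cross_vertex (W : CTri) (m : Fin 3) :
    cross (W.v (m + 1) - W.v m) (W.v (m + 2) - W.v m) = W.dbl := by
  fin_cases m <;> simp only [dbl, cross, sub_re, sub_im] <;> simp <;> ring

lemma law_of_sines (W : CTri) : ∃ κ, 0 < κ ∧ ∀ m, W.len m = κ * Real.sin (W.ang m) := by
  have key : ∀ m, W.len (m + 2) * W.len (m + 1) * Real.sin (W.ang m) = W.dbl := by
    intro m
    have h1 : W.len (m + 2) = ‖W.v (m + 1) - W.v m‖ := by
      rw [len, ev, add_two_add_one, add_two_add_two]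
    have h2 : W.len (m + 1) = ‖W.v (m + 2) - W.v m‖ := by
      rw [len, ev, add_one_add_one, add_one_add_two, norm_sub_rev]
    rw [ang, ← W.cross_vertex m, h1, h2]
    refine sin_arg_div ?_ ?_ <;> rw [← norm_ne_zero_iff]
    · rw [← h1]; exact (W.len_pos _).ne'
    · rw [← h2]; exact (W.len_pos _).ne'
  have h0 := W.len_pos 0
  have h1 := W.len_pos 1
  have h2 := W.len_pos 2
  refine ⟨W.len 0 * W.len 1 * W.len 2 / W.dbl, by have := W.dbl_pos; positivity, fun m => ?_⟩
  have hd := W.dbl_pos.ne'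
  rw [div_mul_eq_mul_div, eq_div_iff hd, ← key m]
  fin_cases m <;> simp <;> ring

lemma len_lt_add (W : CTri) (m : Fin 3) : W.len m < W.len (m + 1) + W.len (m + 2) := by
  obtain ⟨κ, hκ, h⟩ := W.law_of_sines
  rw [h, h, h, ← mul_add]
  refine mul_lt_mul_of_pos_left ?_ hκ
  have hs : W.ang m = Real.pi - (W.ang (m + 1) + W.ang (m + 2)) := by
    have := W.sum_ang
    rw [Fin.sum_univ_three] at this
    fin_cases m <;> simp <;> linarith
  have h1 := W.ang_mem (m + 1)
  have h2 := W.ang_mem (m + 2)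
  have s1 := Real.sin_pos_of_pos_of_lt_pi h1.1 h1.2
  have s2 := Real.sin_pos_of_pos_of_lt_pi h2.1 h2.2
  have c1 : Real.cos (W.ang (m + 1)) < 1 := by
    rw [← Real.cos_zero]
    exact Real.cos_lt_cos_of_nonneg_of_le_pi le_rfl h1.2.le h1.1
  have c2 : Real.cos (W.ang (m + 2)) < 1 := by
    rw [← Real.cos_zero]
    exact Real.cos_lt_cos_of_nonneg_of_le_pi le_rfl h2.2.le h2.1
  rw [hs, Real.sin_pi_sub, Real.sin_add]
  nlinarith

end CTri

/-- If positive multiples of `a` and of `b` are natural combinations of the respective other two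
sides, then elimination of `c` shows that `a / b` is rational. -/
lemma exists_rat_of_relations {a b c : ℝ} (hb : 0 < b) {n m k n' m' k' : ℕ}
    (hn : n ≠ 0) (hn' : n' ≠ 0) (h : n * a = m * b + k * c) (h' : n' * b = m' * a + k' * c) :
    ∃ q : ℚ, a = q * b := by
  have hnr : (0 : ℝ) < n := by exact_mod_cast Nat.pos_of_ne_zero hn
  have hnr' : (0 : ℝ) < n' := by exact_mod_cast Nat.pos_of_ne_zero hn'
  rcases Nat.eq_zero_or_pos k' with rfl | hk
  · have hm : (m' : ℝ) ≠ 0 := by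
      intro h0
      rw [h0] at h'
      have := mul_pos hnr' hb
      simp at h'
      rcases h' with h' | h'
      · exact hn' h'
      · exact hb.ne' h'
    refine ⟨n' / m', ?_⟩
    push_cast at h' ⊢
    field_simp
    linarith
  · have hk : (0 : ℝ) < k' := by exact_mod_cast hk
    have hpos : (0 : ℝ) < k' * n + k * m' := by positivity
    refine ⟨(k' * m + k * n') / (k' * n + k * m'), ?_⟩
    push_cast
    rw [div_mul_eq_mul_div, eq_div_iff hpos.ne']
    linear_combination k' * h - k * h'

namespace LabeledTiling

variable {ι : Type*} [Fintype ι] {T : ι → CTri} {W : CTri} {s θ : Fin 3 → ℝ}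
  {lab : ι → Fin 3 → Fin 3}

/-- The numbers of tile angles at the corners of the tiled triangle, unless this triangle has the
same angles as the tile. -/
lemma corner_counts (h : LabeledTiling T W s θ lab)
    (hsim : ¬ ∃ f : Fin 3 → Fin 3, f.Injective ∧ ∀ x, W.ang (f x) = θ x) :
    (∀ m, W.ang m = cnt T lab (W.v m) 0 * θ 0 + cnt T lab (W.v m) 1 * θ 1) ∧
    (∀ m, cnt T lab (W.v m) 2 = 0) ∧ ∑ m, cnt T lab (W.v m) 0 = 3 ∧
    ∑ m, cnt T lab (W.v m) 1 = 3 ∧ (∀ m, cnt T lab (W.v m) 0 + cnt T lab (W.v m) 1 ≠ 0) ∧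
    ∀ m, ¬(cnt T lab (W.v m) 0 = 2 ∧ cnt T lab (W.v m) 1 = 2) := by
  have hang : ∀ m, W.ang m = cnt T lab (W.v m) 0 * θ 0 + cnt T lab (W.v m) 1 * θ 1 +
      cnt T lab (W.v m) 2 * θ 2 := fun m => by rw [← h.sum_ang_eq, h.sum_ang_corner]
  have hpos : ∀ m, 0 < cnt T lab (W.v m) 0 + cnt T lab (W.v m) 1 + cnt T lab (W.v m) 2 := by
    intro m
    rw [← card_cornersAt, Finset.card_pos]
    exact h.cornersAt_nonempty m
  generalize hp : (fun m => cnt T lab (W.v m) 0) = p at *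
  generalize hq : (fun m => cnt T lab (W.v m) 1) = q at *
  generalize hr : (fun m => cnt T lab (W.v m) 2) = r at *
  simp only [funext_iff] at hp hq hr
  simp only [hp, hq, hr] at *
  have hsum : ∑ m, p m = ∑ m, q m ∧ ∑ m, q m + 2 * ∑ m, r m = 3 * 1 := by
    refine eq_of_angle_eq h.irr ?_
    have := W.sum_ang
    simp only [hang, Finset.sum_add_distrib, ← Finset.sum_mul] at this
    rw [h.gamma, show θ 0 = Real.pi / 3 - θ 1 by linarith [h.sum]] at this
    push_cast
    linarith
  simp only [Fin.sum_univ_three] at hsum ⊢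
  -- Otherwise there are only three tile angles at the corners, hence one angle of each kind.
  have hr0 : r 0 + r 1 + r 2 = 0 := by
    by_contra hr1
    refine hsim ?_
    have hrow : ∀ m, p m + q m + r m = 1 := by
      have h0 := hpos 0
      have h1 := hpos 1
      have h2 := hpos 2
      intro m
      fin_cases m <;> simp <;> omega
    have hx : ∀ x, ∃ m, ![p, q, r] x m = 1 := by
      intro x
      by_contra! hne
      have h0 := hne 0
      have h1 := hne 1
      have h2 := hne 2
      have r0 := hrow 0
      have r1 := hrow 1
      have r2 := hrow 2
      fin_cases x <;> simp at h0 h1 h2 <;> omega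
    choose f hf using hx
    have f0 : p (f 0) = 1 := hf 0
    have f1 : q (f 1) = 1 := hf 1
    have f2 : r (f 2) = 1 := hf 2
    have r0 := hrow (f 0)
    have r1 := hrow (f 1)
    have r2 := hrow (f 2)
    refine ⟨f, ?_, ?_⟩
    · have n1 : f 0 ≠ f 1 := fun he => by rw [he] at f0; omega
      have n2 : f 0 ≠ f 2 := fun he => by rw [he] at f0; omega
      have n3 : f 1 ≠ f 2 := fun he => by rw [he] at f1; omega
      intro x x' hxx
      fin_cases x <;> fin_cases x' <;> simp_all
    · intro x
      fin_cases x
      · have a1 : q (f 0) = 0 := by omega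
        have a2 : r (f 0) = 0 := by omega
        simp [hang, f0, a1, a2]
      · have a1 : p (f 1) = 0 := by omega
        have a2 : r (f 1) = 0 := by omega
        simp [hang, f1, a1, a2]
      · have a1 : p (f 2) = 0 := by omega
        have a2 : q (f 2) = 0 := by omega
        simp [hang, f2, a1, a2]
  have hrm : ∀ m, r m = 0 := by intro m; fin_cases m <;> simp <;> omega
  simp only [hrm, add_zero] at hpos hang hsum
  refine ⟨fun m => by simp [hang], hrm, by omega, by omega, fun m => (hpos m).ne', ?_⟩
  -- A corner with angle `2 α + 2 β = γ` leaves `α` and `β` for the other two corners.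
  rintro m ⟨hp2, hq2⟩
  have hgam : W.ang m = θ 2 := by
    rw [hang, hp2, hq2, h.gamma]
    push_cast
    linarith [h.sum]
  have h1 := hpos (m + 1)
  have h2 := hpos (m + 2)
  have hps : p m + p (m + 1) + p (m + 2) = 3 := by fin_cases m <;> simp <;> omega
  have hqs : q m + q (m + 1) + q (m + 2) = 3 := by fin_cases m <;> simp <;> omega
  have hinj : Function.Injective ![m + 1, m + 2, m] ∧ Function.Injective ![m + 2, m + 1, m] := by
    clear * - m; revert m; decide
  rcases Nat.eq_zero_or_pos (p (m + 1)) with hz | hz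
  · refine hsim ⟨![m + 2, m + 1, m], hinj.2, ?_⟩
    have a1 : p (m + 2) = 1 := by omega
    have a2 : q (m + 2) = 0 := by omega
    have a3 : q (m + 1) = 1 := by omega
    intro x
    fin_cases x
    · simp [hang, a1, a2]
    · simp [hang, a3, hz]
    · exact hgam
  · refine hsim ⟨![m + 1, m + 2, m], hinj.1, ?_⟩
    have a1 : p (m + 1) = 1 := by omega
    have a2 : q (m + 2) = 1 := by omega
    have a3 : q (m + 1) = 0 := by omega
    have a4 : p (m + 2) = 0 := by omega
    intro x
    fin_cases x
    · simp [hang, a1, a3]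
    · simp [hang, a2, a4]
    · exact hgam

lemma exists_nat_relation_zero (h : LabeledTiling T W s θ lab)
    (h2 : ∀ m, cnt T lab (W.v m) 2 = 0) :
    ∃ n m k : ℕ, n ≠ 0 ∧ n * s 0 = m * s 1 + k * s 2 := by
  obtain ⟨a, h1, hp, h3⟩ := h.exists_relation h2 (y := 0) (by decide)
  have e1 : {x : Fin 3 | x = 0 ↔ True} = {0} := by ext x; simp
  have e2 : {x : Fin 3 | x = 0 ↔ False} = {1, 2} := by ext x; fin_cases x <;> simp
  rw [sideSums, e1, Set.image_singleton, AddSubmonoid.mem_closure_singleton] at h1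
  rw [sideSums, e2, Set.image_pair, AddSubmonoid.mem_closure_pair] at h3
  obtain ⟨n, rfl⟩ := h1
  obtain ⟨m, k, h4⟩ := h3
  simp only [nsmul_eq_mul] at h4
  refine ⟨n, m, k, ?_, h4.symm⟩
  rintro rfl
  simp at hp

lemma exists_nat_relation_one (h : LabeledTiling T W s θ lab)
    (h2 : ∀ m, cnt T lab (W.v m) 2 = 0) :
    ∃ n m k : ℕ, n ≠ 0 ∧ n * s 1 = m * s 0 + k * s 2 := by
  obtain ⟨a, h1, hp, h3⟩ := h.exists_relation h2 (y := 1) (by decide)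
  have e1 : {x : Fin 3 | x = 1 ↔ True} = {1} := by ext x; simp
  have e2 : {x : Fin 3 | x = 1 ↔ False} = {0, 2} := by ext x; fin_cases x <;> simp
  rw [sideSums, e1, Set.image_singleton, AddSubmonoid.mem_closure_singleton] at h1
  rw [sideSums, e2, Set.image_pair, AddSubmonoid.mem_closure_pair] at h3
  obtain ⟨n, rfl⟩ := h1
  obtain ⟨m, k, h4⟩ := h3
  simp only [nsmul_eq_mul] at h4
  refine ⟨n, m, k, ?_, h4.symm⟩
  rintro rfl
  simp at hp

lemma exists_tile (h : LabeledTiling T W s θ lab) : Nonempty ι := by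
  obtain ⟨c, -⟩ := h.cornersAt_nonempty 0
  exact ⟨c.1⟩

lemma tile_law_of_sines (h : LabeledTiling T W s θ lab) :
    ∃ t, 0 < t ∧ ∀ x, Real.sin (θ x) = t * s x ∧ 0 < θ x := by
  obtain ⟨i⟩ := h.exists_tile
  obtain ⟨κ, hκ, hl⟩ := (T i).law_of_sines
  have key : ∀ x, s x = κ * Real.sin (θ x) ∧ 0 < θ x := by
    intro x
    have : ∃ k, lab i k = x := by
      rcases (h.tile i).lab_eq with hl | hl
      · exact ⟨x, hl x⟩
      · exact ⟨-x, by rw [hl, neg_neg]⟩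
    obtain ⟨k, rfl⟩ := this
    rw [← (h.tile i).len_eq, ← (h.tile i).ang_eq]
    exact ⟨hl k, ((T i).ang_mem k).1⟩
  refine ⟨κ⁻¹, inv_pos.mpr hκ, fun x => ⟨?_, (key x).2⟩⟩
  rw [(key x).1]
  field_simp

/-- The sides of the tile are commensurable, unless the tiled triangle has the same angles as the
tile. -/
theorem exists_rat_ratio (h : LabeledTiling T W s θ lab)
    (hsim : ¬ ∃ f : Fin 3 → Fin 3, f.Injective ∧ ∀ x, W.ang (f x) = θ x) (i j : Fin 3) :
    ∃ q : ℚ, s i / s j = q := by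
  obtain ⟨hang, hr, hp, hq, hz, h22⟩ := h.corner_counts hsim
  obtain ⟨t, ht, hsin⟩ := h.tile_law_of_sines
  obtain ⟨κ, hκ, hlaw⟩ := W.law_of_sines
  obtain ⟨i₀⟩ := h.exists_tile
  have hs := h.side_pos i₀
  set p := fun m => cnt T lab (W.v m) 0 with hp_def
  set q := fun m => cnt T lab (W.v m) 1 with hq_def
  have h2 : Real.sin (2 * Real.pi / 3) = t * s 2 := by rw [← h.gamma]; exact (hsin 2).1
  have h3 : Real.sqrt 3 ^ 2 = 3 := Real.sq_sqrt (by norm_num)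
  have habc : s 2 ^ 2 = s 0 ^ 2 + s 0 * s 1 + s 1 ^ 2 := by
    have e1 : Real.sin (θ 1) = Real.sqrt 3 / 2 * Real.cos (θ 0) - 1 / 2 * Real.sin (θ 0) := by
      rw [show θ 1 = Real.pi / 3 - θ 0 by linarith [h.sum], Real.sin_sub, Real.sin_pi_div_three,
        Real.cos_pi_div_three]
    have e2 : Real.sqrt 3 / 2 = t * s 2 := by
      rw [← h2, show 2 * Real.pi / 3 = Real.pi - Real.pi / 3 by ring, Real.sin_pi_sub,
        Real.sin_pi_div_three]
    have e3 := Real.sin_sq_add_cos_sq (θ 0)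
    have e4 : (t * s 2) ^ 2 = (t * s 0) ^ 2 + (t * s 0) * (t * s 1) + (t * s 1) ^ 2 := by
      rw [← e2, ← (hsin 0).1, ← (hsin 1).1, e1]
      linear_combination (1 / 4 - Real.cos (θ 0) ^ 2 / 4) * h3 - 3 / 4 * e3
    refine mul_left_cancel₀ (pow_ne_zero 2 ht.ne') ?_
    linear_combination e4
  have hne : s 0 ≠ s 1 := by
    intro he
    have hsin01 : Real.sin (θ 0) = Real.sin (θ 1) := by rw [(hsin 0).1, (hsin 1).1, he]
    have p0 := (hsin 0).2
    have p1 := (hsin 1).2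
    have hpi := Real.pi_pos
    have := Real.injOn_sin ⟨by linarith, by linarith [h.sum]⟩ ⟨by linarith, by linarith [h.sum]⟩
      hsin01
    refine h.irr (1 / 6) ?_
    push_cast
    linarith [h.sum]
  have hL : ∀ m, W.len m = (κ * t / s 2 ^ 2) * sineNum (s 0) (s 1) (s 2) (p m) (q m) := by
    intro m
    have hmem : (p m, q m) ∈ [(1, 0), (0, 1), (1, 1), (1, 2), (2, 1), (2, 0), (1, 3), (0, 2),
        (3, 1), (3, 0), (0, 3)] := by
      have z0 := hz 0
      have z1 := hz 1
      have z2 := hz 2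
      rw [Fin.sum_univ_three] at hp hq
      have b1 : p m ≤ 3 ∧ q m ≤ 3 ∧ 1 ≤ p m + q m ∧ p m + q m ≤ 4 := by
        fin_cases m <;> simp only [hp_def, hq_def] <;> simp <;> omega
      have b2 := h22 m
      change ¬(p m = 2 ∧ q m = 2) at b2
      generalize p m = x at *
      generalize q m = z at *
      obtain ⟨c1, c2, c3, c4⟩ := b1
      interval_cases x <;> interval_cases z <;> simp at c3 c4 b2 ⊢
    have := sin_mul_add_mul ht h.sum (hsin 0).1 (hsin 1).1 h2 habc hmem
    have hs2 := (hs 2).ne'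
    rw [hlaw m, hang m]
    field_simp
    linear_combination this
  -- A corner with angle `p α + q β` has the angle `p π/3 + (q - p) β`.
  have hsums : ∀ σ : ℤˣ, _ := fun σ => exists_rat_sum_sides h.tiling h.tile h.gamma h.sum h.irr σ
    (fun m => (p m : ℤ)) (fun m => (q m : ℤ) - p m) (fun m => by
      rw [hang m]
      push_cast
      rw [show θ 0 = Real.pi / 3 - θ 1 by linarith [h.sum]]
      ring) (by exact_mod_cast hp) (by
      rw [Finset.sum_sub_distrib]
      have : ((∑ m, q m : ℕ) : ℤ) = (∑ m, p m : ℕ) := by rw [hp, hq]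
      push_cast at this
      linarith)
  obtain ⟨r, hX⟩ := hsums 1
  obtain ⟨r', hY⟩ := hsums (-1)
  obtain ⟨u, v, hc⟩ := exists_rat_linear (hs 0) (hs 1) hne habc hp hq hz h22 hL W.len_lt_add
    (r := r) (r' := r') (by simpa using hX) (by
      have : ∀ m, (-1 : ℤˣ) ^ (p m : ℤ) * (-1) ^ ((q m : ℤ) - p m) = (-1) ^ q m := by
        intro m
        rw [← zpow_add, add_sub_cancel, zpow_natCast]
      simp only [this] at hY
      simpa using hY)
  obtain ⟨n, m, k, hn, h4⟩ := h.exists_nat_relation_zero hr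
  obtain ⟨n', m', k', hn', h5⟩ := h.exists_nat_relation_one hr
  obtain ⟨w, hw⟩ := exists_rat_of_relations (hs 1) hn hn' h4 h5
  have hall : ∀ x, ∃ q : ℚ, s x = q * s 1 := by
    intro x
    fin_cases x
    · exact ⟨w, hw⟩
    · exact ⟨1, by simp⟩
    · refine ⟨u * w + v, ?_⟩
      push_cast
      rw [hc, hw]
      ring
  obtain ⟨x, hx⟩ := hall i
  obtain ⟨z, hz⟩ := hall j
  refine ⟨x / z, ?_⟩
  rw [hx, hz, mul_div_mul_right _ _ (hs 1).ne']
  push_cast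
  rfl

end LabeledTiling

/-! ### Passage to the complex plane -/

/-- The identification of the Euclidean plane with the complex plane. -/
def toC : Plane ≃ₗᵢ[ℝ] ℂ := Complex.orthonormalBasisOneI.repr.symm

/-- `T` is the triangle `t` in the complex plane, where the `k`-th vertex of `T` is the vertex
`lab k` of `t`; the labels are reversed if the vertices of `t` are ordered clockwise. -/
structure IsModel (t : Tri) (T : CTri) (lab : Fin 3 → Fin 3) : Prop where
  lab_eq : (∀ k, lab k = k) ∨ (∀ k, lab k = -k)
  v_eq : ∀ k, T.v k = toC (t.points (lab k))

lemma cross_ne_zero (t : Tri) :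
    cross (toC (t.points 1) - toC (t.points 0)) (toC (t.points 2) - toC (t.points 0)) ≠ 0 := by
  intro h
  have hind := affineIndependent_iff.mp t.independent Finset.univ
  have key : ∀ w : Fin 3 → ℝ, w 0 + w 1 + w 2 = 0 →
      w 0 * toC (t.points 0) + w 1 * toC (t.points 1) + w 2 * toC (t.points 2) = 0 →
      ∀ e, w e = 0 := by
    intro w hw hz e
    refine hind w (by rwa [Fin.sum_univ_three]) ?_ e (Finset.mem_univ e)
    apply toC.injective
    rw [Fin.sum_univ_three, map_add, map_add, map_smul, map_smul, map_smul, map_zero]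
    simpa only [real_smul] using hz
  generalize toC (t.points 0) = z₀ at *
  generalize toC (t.points 1) = z₁ at *
  generalize toC (t.points 2) = z₂ at *
  simp only [cross, sub_re, sub_im] at h
  have h1 := key ![(z₁ - z₀).re - (z₂ - z₀).re, (z₂ - z₀).re, -(z₁ - z₀).re] (by simp) (by
    apply Complex.ext <;> simp
    · ring
    · linear_combination -h)
  have h2 := key ![(z₁ - z₀).im - (z₂ - z₀).im, (z₂ - z₀).im, -(z₁ - z₀).im] (by simp) (by
    apply Complex.ext <;> simp
    · linear_combination h
    · ring)
  have e1 : (z₁ - z₀).re = 0 := neg_eq_zero.mp (h1 2)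
  have e2 : (z₁ - z₀).im = 0 := neg_eq_zero.mp (h2 2)
  have e3 : z₁ = z₀ := sub_eq_zero.mp (Complex.ext e1 e2)
  have h3 := key ![1, -1, 0] (by simp) (by simp [e3]) 0
  simp at h3

lemma exists_isModel (t : Tri) : ∃ T lab, IsModel t T lab := by
  rcases (cross_ne_zero t).lt_or_gt with h | h
  · refine ⟨⟨fun k => toC (t.points (-k)), ?_⟩, fun k => -k, Or.inr fun _ => rfl, fun _ => rfl⟩
    rw [cross_swap, neg_pos]
    exact h
  · exact ⟨⟨fun k => toC (t.points k), h⟩, fun k => k, Or.inl fun _ => rfl, fun _ => rfl⟩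

lemma CTri.eq_sum_lam (T : CTri) (x : ℂ) : x = ∑ k, ((T.lam k x / T.dbl : ℝ) : ℂ) * T.v k := by
  have hd := T.dbl_pos.ne'
  rw [Fin.sum_univ_three]
  simp only [lam, ev, dbl] at *
  simp only [cross, sub_re, sub_im] at *
  apply Complex.ext <;> simp only [add_re, add_im, re_ofReal_mul, im_ofReal_mul] <;>
    simp only [Fin.isValue, Fin.reduceAdd] <;> field_simp <;> ring

lemma CTri.sum_lam (T : CTri) (x : ℂ) : ∑ k, T.lam k x = T.dbl := by
  rw [Fin.sum_univ_three]
  simp [lam, ev, dbl, cross]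
  ring

namespace IsModel

variable {t : Tri} {T : CTri} {lab : Fin 3 → Fin 3}

lemma sum_lab (h : IsModel t T lab) {M : Type*} [AddCommMonoid M] (f : Fin 3 → M) :
    ∑ k, f (lab k) = ∑ k, f k := by
  rcases h.lab_eq with hl | hl
  · simp only [hl]
  · simp only [hl]
    exact Equiv.sum_comp (Equiv.neg (Fin 3)) f

lemma lab_lab (h : IsModel t T lab) (k : Fin 3) : lab (lab k) = k := by
  rcases h.lab_eq with hl | hl <;> simp [hl]

lemma mem_setInterior (h : IsModel t T lab) (I : Set ℝ) (x : Plane) :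
    x ∈ t.setInterior I ↔ ∀ k, T.lam k (toC x) / T.dbl ∈ I := by
  have hw : ∑ k, T.lam (lab k) (toC x) / T.dbl = 1 := by
    rw [h.sum_lab fun k => T.lam k (toC x) / T.dbl, ← Finset.sum_div, T.sum_lam,
      div_self T.dbl_pos.ne']
  have hx : x = Finset.univ.affineCombination ℝ t.points
      (fun k => T.lam (lab k) (toC x) / T.dbl) := by
    rw [Finset.affineCombination_eq_linear_combination _ _ _ hw]
    apply toC.injective
    rw [map_sum, ← h.sum_lab]
    simp only [map_smul, h.lab_lab, ← h.v_eq, real_smul]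
    exact T.eq_sum_lam _
  rw [hx, Affine.Simplex.affineCombination_mem_setInterior_iff hw, ← hx]
  exact ⟨fun hk k => by simpa only [h.lab_lab] using hk (lab k), fun hk k => hk _⟩

lemma mem_interior (h : IsModel t T lab) (x : Plane) : x ∈ t.interior ↔ T.Inside (toC x) := by
  rw [Affine.Simplex.interior, h.mem_setInterior]
  have hd := T.dbl_pos
  constructor
  · intro hk k
    exact (div_pos_iff_of_pos_right hd).mp (hk k).1
  · intro hk k
    refine ⟨div_pos (hk k) hd, (div_lt_one hd).mpr ?_⟩
    rw [← T.sum_lam (toC x), Fin.sum_univ_three]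
    have h0 := hk 0
    have h1 := hk 1
    have h2 := hk 2
    fin_cases k <;> simp <;> linarith

lemma mem_closedInterior (h : IsModel t T lab) (x : Plane) :
    x ∈ t.closedInterior ↔ T.Closed (toC x) := by
  rw [Affine.Simplex.closedInterior, h.mem_setInterior]
  have hd := T.dbl_pos
  constructor
  · intro hk k
    have := mul_nonneg (hk k).1 hd.le
    rwa [div_mul_cancel₀ _ hd.ne'] at this
  · intro hk k
    refine ⟨div_nonneg (hk k) hd.le, (div_le_one hd).mpr ?_⟩
    rw [← T.sum_lam (toC x), Fin.sum_univ_three]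
    have h0 := hk 0
    have h1 := hk 1
    have h2 := hk 2
    fin_cases k <;> simp <;> linarith

lemma len_eq (h : IsModel t T lab) (k : Fin 3) : T.len k = side t (lab k) := by
  rw [CTri.len, CTri.ev, h.v_eq, h.v_eq, ← dist_eq_norm, toC.dist_map, side]
  have e1 : -(k + 2) = -k + 1 := by revert k; decide
  have e2 : -(k + 1) = -k + 2 := by revert k; decide
  rcases h.lab_eq with hl | hl <;> simp only [hl, e1, e2]
  rw [dist_comm]

lemma ang_eq (h : IsModel t T lab) (k : Fin 3) : T.ang k = angleAt t (lab k) := by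
  have key : ∀ i, InnerProductGeometry.angle (T.v (i + 2) - T.v i) (T.v (i + 1) - T.v i) =
      T.ang i := by
    intro i
    have h1 : T.v (i + 1) - T.v i ≠ 0 := by
      intro h0
      have := T.v_injective (sub_eq_zero.mp h0)
      clear * - this; revert i; decide
    have h2 : T.v (i + 2) - T.v i ≠ 0 := by
      intro h0
      have := T.v_injective (sub_eq_zero.mp h0)
      clear * - this; revert i; decide
    rw [Complex.angle_eq_abs_arg h2 h1]
    exact abs_of_pos (T.ang_mem i).1
  rw [← key, h.v_eq, h.v_eq, h.v_eq, ← map_sub, ← map_sub, angleAt, EuclideanGeometry.angle,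
    vsub_eq_sub, vsub_eq_sub]
  have e1 : -(k + 2) = -k + 1 := by revert k; decide
  have e2 : -(k + 1) = -k + 2 := by revert k; decide
  have hm : ∀ x y : Plane, InnerProductGeometry.angle (toC x) (toC y) =
      InnerProductGeometry.angle x y := fun x y => toC.toLinearIsometry.angle_map x y
  rw [hm]
  rcases h.lab_eq with hl | hl <;> simp only [hl, e1, e2]
  rw [InnerProductGeometry.angle_comm]

end IsModel

lemma side_eq_of_congruent {t R : Tri} (h : Congruent t.points R.points) (k : Fin 3) :
    side t k = side R k := h.dist_eq _ _

lemma angleAt_eq_of_congruent {t R : Tri} (h : Congruent t.points R.points) (k : Fin 3) :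
    angleAt t k = angleAt R k := EuclideanGeometry.angle_eq_of_congruent h _ _ _

lemma angle_points_perm (t : Tri) (σ : Equiv.Perm (Fin 3)) (k : Fin 3) :
    EuclideanGeometry.angle (t.points (σ (k + 1))) (t.points (σ k)) (t.points (σ (k + 2))) =
      angleAt t (σ k) := by
  have h : (σ (k + 1) = σ k + 1 ∧ σ (k + 2) = σ k + 2) ∨
      (σ (k + 1) = σ k + 2 ∧ σ (k + 2) = σ k + 1) := by
    revert σ k; decide
  rcases h with ⟨h1, h2⟩ | ⟨h1, h2⟩ <;> rw [h1, h2, angleAt]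
  rw [EuclideanGeometry.angle_comm]

/-- Triangles with the same angles are similar. -/
lemma isSimilar_of_angleAt_eq {t R : Tri} (σ : Equiv.Perm (Fin 3))
    (h : ∀ k, angleAt t (σ k) = angleAt R k) : IsSimilar t R := by
  refine ⟨σ, ?_⟩
  have hind : AffineIndependent ℝ (t.points ∘ σ) :=
    (affineIndependent_equiv σ).mpr t.independent
  have e1 : t.points ∘ σ = ![t.points (σ 0), t.points (σ 1), t.points (σ 2)] := by
    ext k : 1
    fin_cases k <;> rfl
  have e2 : R.points = ![R.points 0, R.points 1, R.points 2] := by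
    ext k : 1
    fin_cases k <;> rfl
  rw [e1] at hind ⊢
  rw [e2]
  refine EuclideanGeometry.similar_of_angle_angle (affineIndependent_iff_not_collinear_set.mp hind) ?_ ?_
  · rw [EuclideanGeometry.angle_comm, EuclideanGeometry.angle_comm (R.points 0)]
    exact (angle_points_perm t σ 1).trans (h 1)
  · rw [EuclideanGeometry.angle_comm, EuclideanGeometry.angle_comm (R.points 1)]
    exact (angle_points_perm t σ 2).trans (h 2)

lemma sum_angleAt (t : Tri) : angleAt t 0 + angleAt t 1 + angleAt t 2 = Real.pi := by
  obtain ⟨T, lab, h⟩ := exists_isModel t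
  rw [← Fin.sum_univ_three, ← h.sum_lab, ← T.sum_ang]
  exact Finset.sum_congr rfl fun k _ => (h.ang_eq k).symm

end TriangleTiling

end

theorem theorem1 (ABC R : TriangleTiling.Tri)
    (hangle : TriangleTiling.angleAt R 2 = 2 * Real.pi / 3)
    (hnoncomm : ¬ TriangleTiling.CommensurableAngles R)
    (N : ℕ) (t : Fin N → TriangleTiling.Tri)
    (htiling : TriangleTiling.IsTiling ABC R t)
    (hsim : ¬ TriangleTiling.IsSimilar ABC R) :
    TriangleTiling.CommensurableSides R := by
  obtain ⟨W, labW, hW⟩ := TriangleTiling.exists_isModel ABC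
  choose T lab hT using fun i => TriangleTiling.exists_isModel (t i)
  have hsum : TriangleTiling.angleAt R 0 + TriangleTiling.angleAt R 1 = Real.pi / 3 := by
    linarith [TriangleTiling.sum_angleAt R]
  have h : TriangleTiling.LabeledTiling T W (TriangleTiling.side R) (TriangleTiling.angleAt R)
      lab := by
    refine ⟨⟨fun i j x hi hj => ?_, fun x => ?_⟩, fun i => ⟨(hT i).lab_eq, fun k => ?_,
      fun k => ?_⟩, hangle, hsum, fun q hq => hnoncomm fun i => ?_⟩
    · by_contra hij
      rw [← TriangleTiling.toC.apply_symm_apply x] at hi hj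
      exact Set.disjoint_left.mp (htiling.nonoverlapping i j hij) (((hT i).mem_interior _).mpr hi)
        (((hT j).mem_interior _).mpr hj)
    · have := Set.ext_iff.mp htiling.union_eq (TriangleTiling.toC.symm x)
      simpa only [Set.mem_iUnion, (hT _).mem_closedInterior, hW.mem_closedInterior,
        TriangleTiling.toC.apply_symm_apply] using this
    · rw [(hT i).len_eq, TriangleTiling.side_eq_of_congruent (htiling.congruent i)]
    · rw [(hT i).ang_eq, TriangleTiling.angleAt_eq_of_congruent (htiling.congruent i)]
    · fin_cases i
      · refine ⟨1 / 3 - q, ?_⟩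
        push_cast
        linarith
      · exact ⟨q, hq⟩
      · refine ⟨2 / 3, ?_⟩
        push_cast
        linarith
  refine h.exists_rat_ratio ?_
  rintro ⟨f, hf, hfa⟩
  have hinv : Function.Injective labW := Function.Involutive.injective hW.lab_lab
  refine hsim (TriangleTiling.isSimilar_of_angleAt_eq
    (Equiv.ofBijective (labW ∘ f) (Finite.injective_iff_bijective.mp (hinv.comp hf))) fun k => ?_)
  rw [← hfa k, hW.ang_eq]
  rfl
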